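/- \textbf{Setting.} Let $\Omega\subset\mathbb{R}^2$ be a simply connected polygonal domain, $\partial\Omega=\overline{\Gamma_D\cup\Gamma_N}$ with $\Gamma_D\cap\Gamma_N=\emptyset$ and $|\Gamma_D|>0$. Let $\mu>0$, $\lambda>0$, $f\in L^2(\Omega,\mathbb{R}^2)$, and let $u_D$, $t_N$ be integrable on $\Gamma_D$, $\Gamma_N$. Let $\mathcal T_h$ be a mesh of $\Omega$ without hanging nodes, consisting either of triangles only or of convex quadrilaterals only. Each (open) element is $K=F_K(\hat K)$, where $\hat K$ is the unit triangle $\{\hat x_1,\hat x_2>0,\ \hat x_1+\hat x_2<1\}$ and $F_K$ is affine, or $\hat K=(-1,1)^2$ and $F_K$ is bilinear; $DF_K$ is the Jacobian matrix of $F_K$, $JF_K=\det DF_K$, and $n^{\partial K}$ is the outer unit normal. Fix an integer $r\ge 1$. \textbf{Polynomials.} $P_k$: total degree $\le k$; $\tilde P_k$: homogeneous of degree $k$; $P_{k,l}$: degree $\le k$ in the first and $\le l$ in the second variable; $Q_k=P_{k,k}$; $R_k$: span of the monomials of $Q_{k+1}$ except $x_1^{k+1}x_2^{k+1}$. For vector-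 or tensor-valued functions these are taken componentwise. $E_k(\partial K,\mathbb{R}^2)$ denotes the functions on $\partial K$ that are polynomials of degree $\le k$ on each edge. With $\phi_1=1-\hat x_1-\hat x_2$, $\phi_2=\hat x_1$, $\phi_3=\hat x_2$, let $P_k^{PH}=P_k$ for $k$ odd, and $P_k^{PH}=P_k+\mathrm{span}\{v_0^T\}$ for $k$ even, where $v_0^T=(\phi_1-\phi_2)(\phi_2-\phi_3)(\phi_3-\phi_1)\big[(\phi_1\phi_2)^{\frac{k-2}2}+(\phi_2\phi_3)^{\frac{k-2}2}+(\phi_3\phi_1)^{\frac{k-2}2}\big]$. With $b_i=(1+\hat x_i)(1-\hat x_i)$, let $Q_k^{PH}=Q_k+\mathrm{span}\{v_0^Q\}$, where $v_0^Q=(b_1-b_2)(b_1^{\frac{k-1}2}+b_2^{\frac{k-1}2})$ for $k$ odd and $v_0^Q=\hat x_1\hat x_2(b_1-b_2)(b_1^{\frac{k-2}2}+b_2^{\frac{k-2}2})$ for $k$ even. \textbf{Discrete problem.} Let $\mathcal X_h$ be the space of $v$ with $v|_K=\hat v\circ F_K^{-1}$ for all $K$, where the components of $\hat v$ lie in $P^{PH}_{r+1}+\phi_1\phi_2\phi_3\tilde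 P_{r-1}$ (triangles) or $Q^{PH}_{r+1}$ (quadrilaterals). Let $\mathcal M_h$ be the space of $l=(l|_{\partial K})_K$ with $l|_{\partial K}=\hat l\circ F_K^{-1}$, $\hat l\in E_r(\partial\hat K,\mathbb{R}^2)$, $l=0$ on $\Gamma_N$, and $l|_{\partial K_1}+l|_{\partial K_2}=0$ on $\partial K_1\cap\partial K_2$ for all neighbours $K_1,K_2$. Let $\mathcal P_h$ be the space of $q$ with $q|_K\in P_r(K)$ for all $K$, and with $\int_\Omega q=0$ if $\Gamma_D=\partial\Omega$. Let $(u_h,m_h,p_h)\in\mathcal X_h\times\mathcal M_h\times\mathcal P_h$ satisfy, for all $(v,l,q)\in\mathcal X_h\times\mathcal M_h\times\mathcal P_h$, with $\varepsilon(v)=\tfrac12(\nabla v+\nabla v^t)$, $$\sum_K\Big(\int_K 2\mu\,\varepsilon(u_h):\varepsilon(v)-\int_{\partial K}m_h\cdot v+\int_K p_h\,\mathrm{div}\,v\Big)=-\int_\Omega f\cdot v+\int_{\Gamma_N}t_N\cdot v,$$ $$-\sum_K\int_{\partial K}l\cdot u_h=-\int_{\Gamma_D}l\cdot u_D,\qquad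 \sum_K\int_K q\,\mathrm{div}\,u_h-\frac1\lambda\int_\Omega p_h q=0.$$ \textbf{Stress recovery.} Let $t_h=t_N$ on $\partial K\cap\Gamma_N$ and $t_h=m_h$ on $\partial K\setminus\Gamma_N$. Let $\mathcal S_K^r$ be the set of Piola images $\tau(x)=JF_K(\hat x)^{-1}\,\hat\tau(\hat x)\,DF_K(\hat x)^t$, $x=F_K(\hat x)$, of tensors $\hat\tau$ whose rows lie in $P_r(\hat K,\mathbb{R}^2)+\hat x\,\tilde P_r(\hat K)$ (triangles) or $P_{r+2,r}\times P_{r,r+2}$ (quadrilaterals). Let $\Psi_r(K)$ be $P_{r-1}(K,\mathbb{R}^{2\times2})$ for triangles and $\{(\hat\tau\circ F_K^{-1})\,DF_K^{-1}:\ \text{rows of }\hat\tau\text{ in }P_{r-1,r}\times P_{r,r-1}\}$ for quadrilaterals. Let $\Phi_r(K)$ consist of the $\hat\phi\circ F_K^{-1}$ with components of $\hat\phi$ in $\mathrm{span}\{\hat x_1^{r+1}\hat x_2^s,\ \hat x_1^s\hat x_2^{r+1}:0\le s\le r\}$. Suppose that for every $K$ the field $\sigma_h|_K\in\mathcal S_K^r$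 satisfies $$\int_{\partial K}(\sigma_h n^{\partial K})\cdot l=\int_{\partial K}t_h\cdot l\quad\forall l\in E_r(\partial K,\mathbb{R}^2),\qquad \int_K\sigma_h:\tau=\int_K(2\mu\,\varepsilon(u_h)+p_hI):\tau\quad\forall\tau\in\Psi_r(K),$$ and, if $K$ is a quadrilateral, also $\int_K\mathrm{div}\,\sigma_h\cdot\phi=\int_K f\cdot\phi$ for all $\phi\in\Phi_r(K)$, where $\mathrm{div}$ acts row-wise. \textbf{Lemma (local equilibrium).} Let $\mathcal R_K^r=\{\hat v\circ F_K^{-1}:\hat v\in\hat{\mathcal R}\}$, with $\hat{\mathcal R}=P_r(\hat K,\mathbb{R}^2)$ if $K$ is a triangle and $\hat{\mathcal R}=R_r(\hat K,\mathbb{R}^2)$ if $K$ is a quadrilateral. Then $$\int_K\mathrm{div}\,\sigma_h\cdot v\,dx=\int_K f\cdot v\,dx\qquad\forall v\in\mathcal R_K^r,\ \forall K\in\mathcal T_h.$$ In particular, for $i=1,2$ and every $K\in\mathcal T_h$, with $\sigma_{h,i}$ the $i$-th row of $\sigma_h$, $$\int_{\partial K}\sigma_{h,i}\cdot n^{\partial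 K}\,ds=\int_K f_i\,dx .$$ -/

import Mathlib

open MeasureTheory

namespace HDP

noncomputable section

/-- The Euclidean plane. -/
abbrev Plane := EuclideanSpace ℝ (Fin 2)

/-- Real `2 × 2` tensors. -/
abbrev Tensor := Matrix (Fin 2) (Fin 2) ℝ

/-- Real polynomials in two variables. -/
abbrev Poly := MvPolynomial (Fin 2) ℝ

/-! ### Differential operators and products -/

/-- The `j`-th unit vector. -/
def e (j : Fin 2) : Plane := EuclideanSpace.single j 1

/-- Jacobian matrix of a vector field: `(Dv)_{ij} = ∂_j v_i`. -/
def jac (v : Plane → Plane) (x : Plane) : Tensor :=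
  Matrix.of fun i j => fderiv ℝ v x (e j) i

/-- Infinitesimal strain `ε(v) = (∇v + (∇v)ᵗ)/2`. -/
def strain (v : Plane → Plane) (x : Plane) : Tensor :=
  (1 / 2 : ℝ) • (jac v x + (jac v x).transpose)

/-- Divergence of a vector field. -/
def vdiv (v : Plane → Plane) (x : Plane) : ℝ := (jac v x).trace

/-- Row-wise divergence of a tensor field. -/
def tdiv (τ : Plane → Tensor) (x : Plane) : Plane :=
  WithLp.toLp 2 fun i => ∑ j, fderiv ℝ (fun y => τ y i j) x (e j)

/-- Frobenius product. -/
def frob (A B : Tensor) : ℝ := ∑ i, ∑ j, A i j * B i j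

/-- Matrix-vector product in the plane. -/
def applyT (A : Tensor) (n : Plane) : Plane := WithLp.toLp 2 fun i => ∑ j, A i j * n j

/-- The value of a polynomial at a point. -/
def pev (p : Poly) (x : Plane) : ℝ := MvPolynomial.eval (fun i => x i) p

/-! ### Polynomial spaces -/

/-- `P_r`: total degree at most `r`. -/
def polyP (r : ℕ) : Submodule ℝ Poly := MvPolynomial.restrictTotalDegree (Fin 2) ℝ r

/-- `P̃_r`: homogeneous of degree `r`. -/
def polyPt (r : ℕ) : Submodule ℝ Poly := MvPolynomial.homogeneousSubmodule (Fin 2) ℝ r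

/-- The monomial `x₁^a x₂^b`. -/
def mono (a b : ℕ) : Poly := MvPolynomial.X 0 ^ a * MvPolynomial.X 1 ^ b

/-- `P_{a,b}`: degree at most `a` in `x₁` and at most `b` in `x₂`. -/
def polyPP (a b : ℕ) : Submodule ℝ Poly :=
  Submodule.span ℝ {p | ∃ i j, i ≤ a ∧ j ≤ b ∧ p = mono i j}

/-- `Q_r = P_{r,r}`. -/
def polyQ (r : ℕ) : Submodule ℝ Poly := polyPP r r

/-- `R_r`: spanned by the monomials of `Q_{r+1}` except `x₁^{r+1} x₂^{r+1}`. -/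
def polyR (r : ℕ) : Submodule ℝ Poly :=
  Submodule.span ℝ
    {p | ∃ i j, i ≤ r + 1 ∧ j ≤ r + 1 ∧ (i, j) ≠ (r + 1, r + 1) ∧ p = mono i j}

/-- Barycentric coordinates of the reference triangle. -/
def phi1 : Poly := 1 - MvPolynomial.X 0 - MvPolynomial.X 1
def phi2 : Poly := MvPolynomial.X 0
def phi3 : Poly := MvPolynomial.X 1

/-- The additional function of the triangular enriched space (used for `k` even, `k ≥ 2`). -/
def v0T (k : ℕ) : Poly :=
  (phi1 - phi2) * (phi2 - phi3) * (phi3 - phi1) *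
    ((phi1 * phi2) ^ ((k - 2) / 2) + (phi2 * phi3) ^ ((k - 2) / 2) +
      (phi3 * phi1) ^ ((k - 2) / 2))

/-- `P_k^{PH}` on the reference triangle. -/
def polyPPH (k : ℕ) : Submodule ℝ Poly :=
  if Odd k then polyP k else polyP k ⊔ Submodule.span ℝ {v0T k}

/-- `(1 + x_i)(1 - x_i)`. -/
def qb (i : Fin 2) : Poly := (1 + MvPolynomial.X i) * (1 - MvPolynomial.X i)

/-- The additional function of the quadrilateral enriched space (`k ≥ 1`). -/
def v0Q (k : ℕ) : Poly :=
  if Odd k then (qb 0 - qb 1) * (qb 0 ^ ((k - 1) / 2) + qb 1 ^ ((k - 1) / 2))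
  else MvPolynomial.X 0 * MvPolynomial.X 1 * (qb 0 - qb 1) *
    (qb 0 ^ ((k - 2) / 2) + qb 1 ^ ((k - 2) / 2))

/-- `Q_k^{PH}` on the reference square. -/
def polyQPH (k : ℕ) : Submodule ℝ Poly := polyQ k ⊔ Submodule.span ℝ {v0Q k}

/-- `(φ₁φ₂φ₃) P̃_k`. -/
def bubbleP (k : ℕ) : Submodule ℝ Poly :=
  (polyPt k).map (LinearMap.mulLeft ℝ (phi1 * phi2 * phi3))

/-! ### Elements -/

/-- A mesh consists either of triangles only or of convex quadrilaterals only. -/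
inductive Shape where
  | tri : Shape
  | quad : Shape

/-- Number of vertices. -/
def Shape.n : Shape → ℕ
  | .tri => 3
  | .quad => 4

instance (s : Shape) : NeZero s.n := ⟨by cases s <;> simp [Shape.n]⟩

/-- The open reference element: the unit triangle or the square `(-1,1)²`. -/
def refElem : Shape → Set Plane
  | .tri => {x | 0 < x 0 ∧ 0 < x 1 ∧ x 0 + x 1 < 1}
  | .quad => {x | -1 < x 0 ∧ x 0 < 1 ∧ -1 < x 1 ∧ x 1 < 1}

/-- The vertices of the reference element, counterclockwise. -/
def refVert : (s : Shape) → Fin s.n → Plane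
  | .tri => (![!₂[0, 0], !₂[1, 0], !₂[0, 1]] : Fin 3 → Plane)
  | .quad => (![!₂[-1, -1], !₂[1, -1], !₂[1, 1], !₂[-1, 1]] : Fin 4 → Plane)

/-- The map `F_K` taking the reference element onto the element `K` with vertices `V`: affine for
triangles, bilinear for quadrilaterals; it maps the `i`-th reference vertex to `V i`. -/
def refMap : (s : Shape) → (Fin s.n → Plane) → Plane → Plane
  | .tri, V, x =>
    let W : Fin 3 → Plane := V
    (1 - x 0 - x 1) • W 0 + x 0 • W 1 + x 1 • W 2
  | .quad, V, x =>
    let W : Fin 4 → Plane := V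
    ((1 - x 0) * (1 - x 1) / 4) • W 0 + ((1 + x 0) * (1 - x 1) / 4) • W 1 +
      ((1 + x 0) * (1 + x 1) / 4) • W 2 + ((1 - x 0) * (1 + x 1) / 4) • W 3

/-- The open element `K = F_K(K̂)` with vertices `V`. -/
def elem (s : Shape) (V : Fin s.n → Plane) : Set Plane := refMap s V '' refElem s

/-- The vector product of two plane vectors. -/
def cross (a b : Plane) : ℝ := a 0 * b 1 - a 1 * b 0

/-- `V` lists the vertices of a nondegenerate triangle or of a convex quadrilateral in
counterclockwise order: the boundary polygon turns strictly left at every vertex. -/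
def IsConvexPolygon (s : Shape) (V : Fin s.n → Plane) : Prop :=
  ∀ i, 0 < cross (V (i + 1) - V i) (V (i + 1 + 1) - V (i + 1))

/-- The arc-length measure on the segment from `a` to `b`. -/
def segMeasure (a b : Plane) : Measure Plane :=
  ENNReal.ofReal (dist a b) •
    Measure.map (fun t : ℝ => AffineMap.lineMap a b t) (volume.restrict (Set.Icc 0 1))

/-- The arc-length measure on the `i`-th edge, which joins `V i` to `V (i + 1)`. -/
def edgeMeasure (s : Shape) (V : Fin s.n → Plane) (i : Fin s.n) : Measure Plane :=
  segMeasure (V i) (V (i + 1))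

/-- The arc-length measure on the boundary of the polygon. -/
def bdryMeasure (s : Shape) (V : Fin s.n → Plane) : Measure Plane := ∑ i, edgeMeasure s V i

/-- The unit normal on the `i`-th edge, outward because of the counterclockwise ordering. -/
def outNormal (s : Shape) (V : Fin s.n → Plane) (i : Fin s.n) : Plane :=
  (dist (V i) (V (i + 1)))⁻¹ • !₂[(V (i + 1) - V i) 1, -((V (i + 1) - V i) 0)]

/-- The boundary integral `∫_{∂K} (τ n) · l ds`. -/
def bdryTraction (s : Shape) (V : Fin s.n → Plane) (τ : Plane → Tensor) (l : Plane → Plane) : ℝ :=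
  ∑ i, ∫ x, inner ℝ (applyT (τ x) (outNormal s V i)) (l x) ∂(edgeMeasure s V i)

/-! ### Local spaces

Local functions are given on the closed element, so that their boundary values are meaningful;
they are represented by functions on the plane whose values elsewhere are immaterial. -/

/-- The vector functions `v̂ ∘ F_K⁻¹` with both components of `v̂` in `S`. -/
def mapped (s : Shape) (V : Fin s.n → Plane) (S : Submodule ℝ Poly) : Set (Plane → Plane) :=
  {v | ∃ vh : Fin 2 → Poly, (∀ i, vh i ∈ S) ∧
    ∀ x ∈ closure (refElem s), ∀ i, v (refMap s V x) i = pev (vh i) x}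

/-- `E_r(∂K)`: vector functions on the boundary that are polynomials of degree at most `r`
on each edge, as elements of `L²(∂K)`. -/
def spaceE (s : Shape) (V : Fin s.n → Plane) (r : ℕ) : Set (Plane → Plane) :=
  {l | ∀ i, ∃ q : Fin 2 → Poly, (∀ k, q k ∈ polyP r) ∧
    ∀ᵐ x ∂(edgeMeasure s V i), ∀ k, l x k = pev (q k) x}

/-- Reference displacement space (scalar components). -/
def refX (r : ℕ) : Shape → Submodule ℝ Poly
  | .tri => polyPPH (r + 1) ⊔ bubbleP (r - 1)
  | .quad => polyQPH (r + 1)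

/-- Local displacement space of `X_h^{r+1}`. -/
def spaceX (s : Shape) (V : Fin s.n → Plane) (r : ℕ) : Set (Plane → Plane) := mapped s V (refX r s)

/-- Local multiplier space: `l̂ ∘ F_K⁻¹` with `l̂ ∈ E_r(∂K̂)`, as elements of `L²(∂K)`. -/
def spaceM (s : Shape) (V : Fin s.n → Plane) (r : ℕ) : Set (Plane → Plane) :=
  {l | ∃ lh ∈ spaceE s (refVert s) r, ∀ᵐ x ∂(bdryMeasure s (refVert s)), l (refMap s V x) = lh x}

/-- Local pressure space `P_r(K)`. -/
def spaceP (s : Shape) (V : Fin s.n → Plane) (r : ℕ) : Set (Plane → ℝ) :=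
  {p | ∃ q ∈ polyP r, ∀ x ∈ closure (elem s V), p x = pev q x}

/-- Reference stress space: rows in the Raviart-Thomas space `P_r² + x̂ P̃_r` for triangles and in
the Arnold-Boffi-Falk space `P_{r+2,r} × P_{r,r+2}` for quadrilaterals. -/
def refS (r : ℕ) : Shape → Set (Fin 2 → Fin 2 → Poly)
  | .tri => {τ | ∀ i, ∃ p : Fin 2 → Poly, ∃ q ∈ polyPt r, (∀ j, p j ∈ polyP r) ∧
      ∀ j, τ i j = p j + MvPolynomial.X j * q}
  | .quad => {τ | ∀ i, τ i 0 ∈ polyPP (r + 2) r ∧ τ i 1 ∈ polyPP r (r + 2)}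

/-- Local stress space `S_K^r`: the Piola images `(JF_K)⁻¹ τ̂ DF_Kᵗ`. -/
def spaceS (s : Shape) (V : Fin s.n → Plane) (r : ℕ) : Set (Plane → Tensor) :=
  {τ | ∃ τh ∈ refS r s, ∀ x ∈ closure (refElem s),
    τ (refMap s V x) = ((jac (refMap s V) x).det)⁻¹ •
      ((Matrix.of fun i j => pev (τh i j) x) * (jac (refMap s V) x).transpose)}

/-- The auxiliary tensor space `Ψ_r(K)`. -/
def spacePsi (r : ℕ) : (s : Shape) → (Fin s.n → Plane) → Set (Plane → Tensor)
  | .tri, V => {τ | ∃ q : Fin 2 → Fin 2 → Poly, (∀ i j, q i j ∈ polyP (r - 1)) ∧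
      ∀ x ∈ closure (elem .tri V), ∀ i j, τ x i j = pev (q i j) x}
  | .quad, V => {τ | ∃ τh : Fin 2 → Fin 2 → Poly,
      (∀ i, τh i 0 ∈ polyPP (r - 1) r ∧ τh i 1 ∈ polyPP r (r - 1)) ∧
      ∀ x ∈ closure (refElem .quad), τ (refMap .quad V x) =
        (Matrix.of fun i j => pev (τh i j) x) * (jac (refMap .quad V) x)⁻¹}

/-- `span {x₁^{r+1} x₂^k, x₁^k x₂^{r+1} : k = 0, …, r}`. -/
def refPhi (r : ℕ) : Submodule ℝ Poly :=
  Submodule.span ℝ {p | ∃ k, k ≤ r ∧ (p = mono (r + 1) k ∨ p = mono k (r + 1))}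

/-- The auxiliary vector space `Φ_r(K)`, used on quadrilaterals. -/
def spacePhi (s : Shape) (V : Fin s.n → Plane) (r : ℕ) : Set (Plane → Plane) :=
  mapped s V (refPhi r)

/-- The test space `R_K^r`: mapped `P_r` on triangles, mapped `R_r` on quadrilaterals. -/
def spaceR (s : Shape) (V : Fin s.n → Plane) (r : ℕ) : Set (Plane → Plane) :=
  mapped s V (match s with | .tri => polyP r | .quad => polyR r)

/-! ### Meshes -/

/-- A mesh of `Ω` without hanging nodes, made of triangles or of convex quadrilaterals; `ι` indexes
the elements. -/
structure Mesh (s : Shape) (ι : Type*) (Ω : Set Plane) where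
  vert : ι → Fin s.n → Plane
  convex : ∀ K, IsConvexPolygon s (vert K)
  subset : ∀ K, elem s (vert K) ⊆ Ω
  disjoint : ∀ K L, K ≠ L → Disjoint (elem s (vert K)) (elem s (vert L))
  cover : closure Ω = ⋃ K, closure (elem s (vert K))
  /-- Two closed elements share nothing, a common vertex, or a common edge. -/
  conforming : ∀ K L, K ≠ L →
    closure (elem s (vert K)) ∩ closure (elem s (vert L)) = ∅ ∨
    (∃ i j, vert K i = vert L j ∧
      closure (elem s (vert K)) ∩ closure (elem s (vert L)) = {vert K i}) ∨
    (∃ i j, vert K i = vert L (j + 1) ∧ vert K (i + 1) = vert L j ∧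
      closure (elem s (vert K)) ∩ closure (elem s (vert L)) =
        segment ℝ (vert K i) (vert K (i + 1)))

/-! ### The discrete problem

Functions on a mesh are families indexed by the elements; integrals over `Ω`, `Γ_D` and `Γ_N` are
sums of the contributions of the elements. -/

section Discrete

variable {s : Shape} {ι : Type*} [Fintype ι] {Ω : Set Plane}

/-- The displacement space `X_h^{r+1}`. -/
def globX (T : Mesh s ι Ω) (r : ℕ) : Set (ι → Plane → Plane) :=
  {v | ∀ K, v K ∈ spaceX s (T.vert K) r}

/-- The multiplier space `M_h^r`: vanishing on `Γ_N`, opposite values from the two sides of an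
interface. -/
def globM (T : Mesh s ι Ω) (ΓN : Set Plane) (r : ℕ) : Set (ι → Plane → Plane) :=
  {l | (∀ K, l K ∈ spaceM s (T.vert K) r) ∧
    (∀ K, ∀ᵐ x ∂(bdryMeasure s (T.vert K)), x ∈ ΓN → l K x = 0) ∧
    ∀ K L, K ≠ L → ∀ᵐ x ∂(bdryMeasure s (T.vert K)),
      x ∈ frontier (elem s (T.vert L)) → l K x + l L x = 0}

/-- The pressure space `P_h^r`: piecewise `P_r`, with zero mean when `Γ_D = ∂Ω`. -/
def globP (T : Mesh s ι Ω) (ΓD : Set Plane) (r : ℕ) : Set (ι → Plane → ℝ) :=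
  {p | (∀ K, p K ∈ spaceP s (T.vert K) r) ∧
    (ΓD = frontier Ω → ∑ K, ∫ x in elem s (T.vert K), p K x = 0)}

/-- `a(u, v) = (2μ ε(u), ε(v))`. -/
def formA (T : Mesh s ι Ω) (μ : ℝ) (u v : ι → Plane → Plane) : ℝ :=
  ∑ K, ∫ x in elem s (T.vert K), frob ((2 * μ) • strain (u K) x) (strain (v K) x)

/-- `b(v, l) = -⟨l, v⟩` over all element boundaries. -/
def formB (T : Mesh s ι Ω) (v l : ι → Plane → Plane) : ℝ :=
  -∑ K, ∫ x, inner ℝ (l K x) (v K x) ∂(bdryMeasure s (T.vert K))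

/-- `c(v, q) = (div v, q)`. -/
def formC (T : Mesh s ι Ω) (v : ι → Plane → Plane) (q : ι → Plane → ℝ) : ℝ :=
  ∑ K, ∫ x in elem s (T.vert K), vdiv (v K) x * q K x

/-- `(f, v)_Ω`. -/
def loadForm (T : Mesh s ι Ω) (f : Plane → Plane) (v : ι → Plane → Plane) : ℝ :=
  ∑ K, ∫ x in elem s (T.vert K), inner ℝ (f x) (v K x)

/-- `⟨g, v⟩_Γ` for a part `Γ` of the boundary of `Ω`. -/
def bdryForm (T : Mesh s ι Ω) (Γ : Set Plane) (g : Plane → Plane) (v : ι → Plane → Plane) : ℝ :=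
  ∑ K, ∫ x in Γ, inner ℝ (g x) (v K x) ∂(bdryMeasure s (T.vert K))

/-- `(p, q)_Ω`. -/
def massForm (T : Mesh s ι Ω) (p q : ι → Plane → ℝ) : ℝ :=
  ∑ K, ∫ x in elem s (T.vert K), p K x * q K x

/-- `(u, m, p)` solves the discrete displacement-multiplier-pressure problem in
`X_h^{r+1} × M_h^r × P_h^r`. -/
structure IsHDPSolution (T : Mesh s ι Ω) (r : ℕ) (ΓD ΓN : Set Plane) (μ lam : ℝ)
    (f uD tN : Plane → Plane) (u m : ι → Plane → Plane) (p : ι → Plane → ℝ) : Prop where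
  mem_X : u ∈ globX T r
  mem_M : m ∈ globM T ΓN r
  mem_P : p ∈ globP T ΓD r
  equilibrium : ∀ v ∈ globX T r,
    formA T μ u v + formB T v m + formC T v p = -loadForm T f v + bdryForm T ΓN tN v
  continuity : ∀ l ∈ globM T ΓN r,
    formB T u l = -bdryForm T ΓD uD l
  pressure : ∀ q ∈ globP T ΓD r,
    formC T u q - (1 / lam) * massForm T p q = 0

/-- The traction `t_h` on the boundary of one element: `t_N` on `Γ_N` and the multiplier
elsewhere. -/
def traction (ΓN : Set Plane) (tN mK : Plane → Plane) (x : Plane) : Plane :=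
  ΓN.indicator tN x + ΓNᶜ.indicator mK x

/-- `σK` solves the local stress recovery problem on the element with vertices `V`, for the local
displacement `uK`, multiplier `mK` and pressure `pK`. -/
structure IsRecoveredStress (s : Shape) (V : Fin s.n → Plane) (r : ℕ) (ΓN : Set Plane) (μ : ℝ)
    (f tN uK mK : Plane → Plane) (pK : Plane → ℝ) (σK : Plane → Tensor) : Prop where
  mem_S : σK ∈ spaceS s V r
  normal : ∀ l ∈ spaceE s V r,
    bdryTraction s V σK l = ∫ x, inner ℝ (traction ΓN tN mK x) (l x) ∂(bdryMeasure s V)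
  inside : ∀ τ ∈ spacePsi r s V,
    ∫ x in elem s V, frob (σK x) (τ x) =
      ∫ x in elem s V, frob ((2 * μ) • strain uK x + pK x • (1 : Tensor)) (τ x)
  extra : s = Shape.quad → ∀ φ ∈ spacePhi s V r,
    ∫ x in elem s V, inner ℝ (tdiv σK x) (φ x) = ∫ x in elem s V, inner ℝ (f x) (φ x)

end Discrete

end

end HDP

open HDP

/-!
Every element map is a bilinear map `F` (`d = 0` for triangles), and convexity of the element makes
`det DF` positive on the closed reference element (`jac_refMap_det_pos`); since an increment of a
bilinear map is its differential at the midpoint, `F` is injective there (`bil_injOn`). All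
integrals are therefore pulled back to the reference element, where only polynomials occur. The
Piola transformation preserves divergences and normal fluxes (`tdiv_of_pullback`,
`bdryTraction_piola`), so the divergence theorem for polynomials on the reference element
(`divergence_refElem`) becomes Green's formula `(div σ, v) = ⟨σ n, v⟩ - (σ, ∇v)` on the element
(`green_elem`).

Let `v̂` have components in `P_r` (triangles) or `Q_r` (quadrilaterals). Then `v` restricts to a
polynomial of degree at most `r` on each edge (`exists_edge_poly`), and `∇v` lies in `Ψ_r(K)`
(`exists_mem_spacePsi`). By the conditions defining the recovered stress, the right-hand side of
Green's formula is `⟨t_h, v⟩ - (2μ ε(u_h) + p_h I, ∇v)`. As `v`, extended by zero, is also an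
admissible displacement, the discrete equilibrium equation identifies this number with `(f, v)`:
the traction `t_h` is `m_h + t_N` on `Γ_N` and `m_h` elsewhere, because `m_h` vanishes on `Γ_N`
(`integral_traction`, `local_equilibrium_testPoly`).

On quadrilaterals `R_r = Q_r + Φ_r` (`polyR_le`), and on `Φ_r(K)` equilibrium is imposed in the
stress recovery. The boundary identity is the case of the constant fields `v = e i`.
-/

/-! ### Bilinear maps of the plane -/

/-- The bilinear map `x ↦ a + x₁ b + x₂ c + x₁ x₂ d`. -/
noncomputable def bil (a b c d x : Plane) : Plane :=
  a + x 0 • b + x 1 • c + (x 0 * x 1) • d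

/-- The Jacobian matrix of `bil a b c d`. -/
def bilJac (b c d x : Plane) : Tensor :=
  !![b 0 + x 1 * d 0, c 0 + x 0 * d 0; b 1 + x 1 * d 1, c 1 + x 0 * d 1]

lemma bil_apply (a b c d x : Plane) (i : Fin 2) :
    bil a b c d x i = a i + x 0 * b i + x 1 * c i + x 0 * x 1 * d i := by
  simp [bil]

lemma plane_eq_sum (x : Plane) : x = x 0 • e 0 + x 1 • e 1 := by
  ext i; fin_cases i <;> simp [e]

lemma clm_apply_eq_sum {F : Type*} [NormedAddCommGroup F] [NormedSpace ℝ F]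
    (L : Plane →L[ℝ] F) (h : Plane) : L h = ∑ k, h k • L (e k) := by
  conv_lhs => rw [plane_eq_sum h]
  simp [Fin.sum_univ_two]

lemma hasStrictFDerivAt_coord (i : Fin 2) (x : Plane) :
    HasStrictFDerivAt (fun y : Plane => y i) (EuclideanSpace.proj (𝕜 := ℝ) i) x :=
  (EuclideanSpace.proj (𝕜 := ℝ) i).hasStrictFDerivAt

/-- The differential of `bil a b c d`. -/
noncomputable def bilDeriv (b c d x : Plane) : Plane →L[ℝ] Plane :=
  Matrix.toEuclideanCLM (n := Fin 2) (𝕜 := ℝ) (bilJac b c d x)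

lemma bilDeriv_apply (b c d x h : Plane) (i : Fin 2) :
    bilDeriv b c d x h i = ∑ k, bilJac b c d x i k * h k := by
  simp [bilDeriv, Matrix.ofLp_toEuclideanCLM, Matrix.mulVec, dotProduct]

lemma bilDeriv_det (b c d x : Plane) : (bilDeriv b c d x).det = (bilJac b c d x).det := by
  unfold bilDeriv ContinuousLinearMap.det
  exact LinearMap.det_toLpLin 2 _

lemma hasStrictFDerivAt_bil (a b c d x : Plane) :
    HasStrictFDerivAt (bil a b c d) (bilDeriv b c d x) x := by
  have h0 := hasStrictFDerivAt_coord 0 x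
  have h1 := hasStrictFDerivAt_coord 1 x
  have h := (((h0.smul_const b).const_add a).add (h1.smul_const c)).add
    ((h0.mul h1).smul_const d)
  refine h.congr_fderiv ?_
  ext v i
  rw [bilDeriv_apply]
  fin_cases i <;> simp [bilJac, Fin.sum_univ_two] <;> ring

lemma jac_bil (a b c d x : Plane) : jac (bil a b c d) x = bilJac b c d x := by
  ext i j
  rw [jac, Matrix.of_apply, (hasStrictFDerivAt_bil a b c d x).hasFDerivAt.fderiv, bilDeriv_apply]
  fin_cases j <;> simp [e]

/-- A bilinear map is injective on a convex set where its Jacobian determinant does not vanish: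
the increment between two points is exactly the differential at the midpoint applied to their
difference. -/
lemma bil_injOn (a b c d : Plane) {S : Set Plane} (hS : Convex ℝ S)
    (hJ : ∀ x ∈ S, (bilJac b c d x).det ≠ 0) : Set.InjOn (bil a b c d) S := by
  intro x hx y hy hxy
  have hm : (1 / 2 : ℝ) • x + (1 / 2 : ℝ) • y ∈ S :=
    hS hx hy (by norm_num) (by norm_num) (by norm_num)
  have hdet := hJ _ hm
  have e0 := congrArg (fun z : Plane => z 0) hxy
  have e1 := congrArg (fun z : Plane => z 1) hxy
  simp only [bil_apply] at e0 e1
  rw [bilJac, Matrix.det_fin_two_of] at hdet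
  simp only [PiLp.add_apply, PiLp.smul_apply, smul_eq_mul] at hdet
  -- Cramer's rule at the midpoint
  have k0 : x 0 - y 0 = 0 := by
    refine (mul_eq_zero.1 ?_).resolve_left hdet
    linear_combination (c 1 + (1 / 2 * x 0 + 1 / 2 * y 0) * d 1) * e0 -
      (c 0 + (1 / 2 * x 0 + 1 / 2 * y 0) * d 0) * e1
  have k1 : x 1 - y 1 = 0 := by
    refine (mul_eq_zero.1 ?_).resolve_left hdet
    linear_combination (b 0 + (1 / 2 * x 1 + 1 / 2 * y 1) * d 0) * e1 -
      (b 1 + (1 / 2 * x 1 + 1 / 2 * y 1) * d 1) * e0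
  ext i
  fin_cases i
  · simpa [sub_eq_zero] using k0
  · simpa [sub_eq_zero] using k1

/-- The differential of a bilinear map, as an equivalence, where the Jacobian is invertible. -/
lemma exists_bilDeriv_equiv {b c d x : Plane} (hJ : (bilJac b c d x).det ≠ 0) :
    ∃ L : Plane ≃L[ℝ] Plane, (L : Plane →L[ℝ] Plane) = bilDeriv b c d x :=
  ⟨(bilDeriv b c d x).toContinuousLinearEquivOfDetNeZero (by rwa [bilDeriv_det]), by ext; rfl⟩

/-- A function whose pullback `g ∘ F = ĝ` under a bilinear map is differentiable is itself
differentiable where the Jacobian of `F` is invertible. -/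
lemma differentiableAt_of_pullback {a b c d : Plane} {U : Set Plane} (hU : IsOpen U)
    {g gh : Plane → ℝ} (hg : ∀ x ∈ U, g (bil a b c d x) = gh x) {x : Plane} (hx : x ∈ U)
    (hgh : DifferentiableAt ℝ gh x) (hJ : (bilJac b c d x).det ≠ 0) :
    DifferentiableAt ℝ g (bil a b c d x) := by
  obtain ⟨L, hL⟩ := exists_bilDeriv_equiv hJ
  have hF : HasStrictFDerivAt (bil a b c d) (L : Plane →L[ℝ] Plane) x :=
    hL ▸ hasStrictFDerivAt_bil a b c d x
  have hinv := hF.to_localInverse.hasFDerivAt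
  have hix := hF.localInverse_apply_image
  -- near `F x`, the function `g` is `ĝ` composed with the local inverse of `F`
  have hev : g =ᶠ[nhds (bil a b c d x)] gh ∘ hF.localInverse (bil a b c d) L x := by
    have hmem : ∀ᶠ y in nhds (bil a b c d x), hF.localInverse (bil a b c d) L x y ∈ U :=
      hF.localInverse_continuousAt (by rw [hix]; exact hU.mem_nhds hx)
    filter_upwards [hmem, hF.eventually_right_inverse] with y hy hy'
    rw [Function.comp_apply, ← hg _ hy, hy']
  refine DifferentiableAt.congr_of_eventuallyEq ?_ hev
  refine DifferentiableAt.comp _ ?_ hinv.differentiableAt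
  rwa [hix]

/-- Chain rule for a function given through its pullback `g ∘ F = ĝ` under a bilinear map `F` with
invertible Jacobian: `∇g ∘ F = ∇ĝ DF⁻¹`. -/
lemma fderiv_of_pullback {a b c d : Plane} {U : Set Plane} (hU : IsOpen U) {g gh : Plane → ℝ}
    (hg : ∀ x ∈ U, g (bil a b c d x) = gh x) {x : Plane} (hx : x ∈ U)
    (hgh : DifferentiableAt ℝ gh x) (hJ : (bilJac b c d x).det ≠ 0) (j : Fin 2) :
    fderiv ℝ g (bil a b c d x) (e j) = ∑ k, fderiv ℝ gh x (e k) * (bilJac b c d x)⁻¹ k j := by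
  have hF := hasStrictFDerivAt_bil a b c d x
  have hgd := differentiableAt_of_pullback hU hg hx hgh hJ
  have hcomp : fderiv ℝ gh x = (fderiv ℝ g (bil a b c d x)).comp (bilDeriv b c d x) := by
    have h1 := (hgd.hasFDerivAt.comp x hF.hasFDerivAt)
    have h2 : gh =ᶠ[nhds x] g ∘ bil a b c d := by
      filter_upwards [hU.mem_nhds hx] with y hy using (hg y hy).symm
    rw [h2.fderiv_eq, h1.fderiv]
  have hk : ∀ k, fderiv ℝ gh x (e k) =
      ∑ i, fderiv ℝ g (bil a b c d x) (e i) * bilJac b c d x i k := by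
    intro k
    rw [hcomp, ContinuousLinearMap.comp_apply, clm_apply_eq_sum]
    refine Finset.sum_congr rfl fun i _ => ?_
    rw [bilDeriv_apply]
    fin_cases k <;> simp [e, mul_comm]
  have hmat := Matrix.mul_nonsing_inv _ hJ.isUnit
  have := congrArg (fun w => Matrix.vecMul (fun i => fderiv ℝ g (bil a b c d x) (e i)) w j) hmat
  simp only [Matrix.vecMul_one] at this
  rw [← this, ← Matrix.vecMul_vecMul]
  simp only [Matrix.vecMul, dotProduct, hk]

/-! ### Polynomials as functions -/

lemma pev_add (p q : Poly) (x : Plane) : pev (p + q) x = pev p x + pev q x := by simp [pev]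
lemma pev_sub (p q : Poly) (x : Plane) : pev (p - q) x = pev p x - pev q x := by simp [pev]
lemma pev_mul (p q : Poly) (x : Plane) : pev (p * q) x = pev p x * pev q x := by simp [pev]
lemma pev_sum {α : Type*} (s : Finset α) (p : α → Poly) (x : Plane) :
    pev (∑ i ∈ s, p i) x = ∑ i ∈ s, pev (p i) x := by simp [pev]
lemma pev_C (t : ℝ) (x : Plane) : pev (MvPolynomial.C t) x = t := by simp [pev]
lemma pev_X (i : Fin 2) (x : Plane) : pev (MvPolynomial.X i) x = x i := by simp [pev]

lemma hasFDerivAt_pev (p : Poly) (x : Plane) :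
    HasFDerivAt (pev p)
      (∑ k, pev (MvPolynomial.pderiv k p) x • EuclideanSpace.proj (𝕜 := ℝ) k) x := by
  induction p using MvPolynomial.induction_on with
  | C t =>
    have : pev (MvPolynomial.C t) = fun _ => t := funext fun x => pev_C t x
    rw [this]
    simpa [pev] using hasFDerivAt_const t x
  | add p q hp hq =>
    have : pev (p + q) = fun y => pev p y + pev q y := funext fun y => pev_add p q y
    rw [this]
    refine (hp.add hq).congr_fderiv ?_
    simp only [map_add, pev_add, add_smul, Finset.sum_add_distrib]
  | mul_X p i hp =>
    have : pev (p * MvPolynomial.X i) = fun y => pev p y * y i :=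
      funext fun y => by rw [pev_mul, pev_X]
    rw [this]
    refine (hp.mul (hasStrictFDerivAt_coord i x).hasFDerivAt).congr_fderiv ?_
    ext v
    simp only [Fin.sum_univ_two, Derivation.leibniz, MvPolynomial.pderiv_X, pev_add, pev_mul,
      smul_eq_mul, pev_X]
    fin_cases i <;> simp [pev] <;> ring

lemma fderiv_pev (p : Poly) (x : Plane) (k : Fin 2) :
    fderiv ℝ (pev p) x (e k) = pev (MvPolynomial.pderiv k p) x := by
  rw [(hasFDerivAt_pev p x).fderiv]
  fin_cases k <;> simp [e, Fin.sum_univ_two]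

lemma differentiable_pev (p : Poly) : Differentiable ℝ (pev p) :=
  fun x => (hasFDerivAt_pev p x).differentiableAt

lemma continuous_pev (p : Poly) : Continuous (pev p) := (differentiable_pev p).continuous

/-- The gradient `∂_j v_i` of a polynomial vector field. -/
noncomputable def polyGrad (v : Fin 2 → Poly) (x : Plane) : Tensor :=
  Matrix.of fun i j => pev (MvPolynomial.pderiv j (v i)) x

lemma jac_of_pullback {a b c d : Plane} {U : Set Plane} (hU : IsOpen U) {v : Plane → Plane}
    {vh : Fin 2 → Poly} (hv : ∀ x ∈ U, ∀ i, v (bil a b c d x) i = pev (vh i) x)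
    {x : Plane} (hx : x ∈ U) (hJ : (bilJac b c d x).det ≠ 0) :
    jac v (bil a b c d x) = polyGrad vh x * (bilJac b c d x)⁻¹ := by
  have hvd : DifferentiableAt ℝ v (bil a b c d x) := differentiableAt_euclidean.2 fun i =>
    differentiableAt_of_pullback hU (g := fun y => v y i) (fun y hy => hv y hy i) hx
      (differentiable_pev _ x) hJ
  ext i j
  have hi : HasFDerivAt (fun y => v y i) ((EuclideanSpace.proj (𝕜 := ℝ) i).comp
      (fderiv ℝ v (bil a b c d x))) (bil a b c d x) :=
    (EuclideanSpace.proj (𝕜 := ℝ) i).hasFDerivAt.comp _ hvd.hasFDerivAt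
  have := fderiv_of_pullback hU (g := fun y => v y i) (fun y hy => hv y hy i) hx
    (differentiable_pev _ x) hJ j
  rw [hi.fderiv] at this
  simpa [jac, Matrix.mul_apply, polyGrad, fderiv_pev] using this

/-- The Piola transformation commutes with the divergence: `div τ ∘ F = (det DF)⁻¹ div τ̂`. -/
lemma tdiv_of_pullback {a b c d : Plane} {U : Set Plane} (hU : IsOpen U) {τ : Plane → Tensor}
    {τh : Fin 2 → Fin 2 → Poly}
    (hτ : ∀ x ∈ U, τ (bil a b c d x) = ((bilJac b c d x).det)⁻¹ •
      ((Matrix.of fun i j => pev (τh i j) x) * (bilJac b c d x).transpose))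
    {x : Plane} (hx : x ∈ U) (hJ : (bilJac b c d x).det ≠ 0) (i : Fin 2) :
    tdiv τ (bil a b c d x) i = ((bilJac b c d x).det)⁻¹ *
      ∑ j, pev (MvPolynomial.pderiv j (τh i j)) x := by
  have h0 := (hasStrictFDerivAt_coord 0 x).hasFDerivAt
  have h1 := (hasStrictFDerivAt_coord 1 x).hasFDerivAt
  have ht0 := hasFDerivAt_pev (τh i 0) x
  have ht1 := hasFDerivAt_pev (τh i 1) x
  have hdet : ∀ y, (bilJac b c d y).det = (b 0 + y 1 * d 0) * (c 1 + y 0 * d 1) -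
      (c 0 + y 0 * d 0) * (b 1 + y 1 * d 1) := fun y => by rw [bilJac, Matrix.det_fin_two_of]
  have hA : ∀ j, HasFDerivAt (fun y => (b j + y 1 * d j) * pev (τh i 0) y +
      (c j + y 0 * d j) * pev (τh i 1) y) _ x := fun j =>
    (((h1.mul_const (d j)).const_add (b j)).mul ht0).add
      (((h0.mul_const (d j)).const_add (c j)).mul ht1)
  have hD : HasFDerivAt (fun y : Plane => (bilJac b c d y).det) _ x :=
    ((((h1.mul_const (d 0)).const_add (b 0)).mul ((h0.mul_const (d 1)).const_add (c 1))).sub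
      (((h0.mul_const (d 0)).const_add (c 0)).mul
        ((h1.mul_const (d 1)).const_add (b 1)))).congr_of_eventuallyEq
      (Filter.Eventually.of_forall hdet)
  have hG : ∀ j, HasFDerivAt (fun y : Plane => ((bilJac b c d y).det)⁻¹ *
      ((b j + y 1 * d j) * pev (τh i 0) y + (c j + y 0 * d j) * pev (τh i 1) y)) _ x := fun j =>
    ((hasDerivAt_inv hJ).comp_hasFDerivAt x hD).mul (hA j)
  have hpull : ∀ j, ∀ y ∈ U, τ (bil a b c d y) i j = ((bilJac b c d y).det)⁻¹ *
      ((b j + y 1 * d j) * pev (τh i 0) y + (c j + y 0 * d j) * pev (τh i 1) y) := by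
    intro j y hy
    rw [hτ y hy, Matrix.smul_apply, smul_eq_mul, Matrix.mul_apply, Fin.sum_univ_two]
    congr 1
    fin_cases j <;> simp [bilJac] <;> ring
  have key : ∀ j, fderiv ℝ (fun y => τ y i j) (bil a b c d x) (e j) = _ := fun j =>
    fderiv_of_pullback hU (g := fun y => τ y i j) (hpull j) hx (hG j).differentiableAt hJ j
  have hsum : tdiv τ (bil a b c d x) i =
    ∑ j, fderiv ℝ (fun y => τ y i j) (bil a b c d x) (e j) := rfl
  have hinv : (bilJac b c d x)⁻¹ = ((bilJac b c d x).det)⁻¹ •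
      !![c 1 + x 0 * d 1, -(c 0 + x 0 * d 0); -(b 1 + x 1 * d 1), b 0 + x 1 * d 0] := by
    rw [Matrix.inv_def, Ring.inverse_eq_inv']
    congr 1
    rw [bilJac, Matrix.adjugate_fin_two_of]
  rw [hsum, Fin.sum_univ_two, key, key, (hG 0).fderiv, (hG 1).fderiv, hinv]
  have hd := hdet x
  have e00 : e 0 0 = 1 := by simp [e]
  have e01 : e 0 1 = 0 := by simp [e]
  have e10 : e 1 0 = 0 := by simp [e]
  have e11 : e 1 1 = 1 := by simp [e]
  simp only [Fin.sum_univ_two, _root_.add_apply, _root_.smul_apply,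
    _root_.sub_apply, PiLp.proj_apply, smul_eq_mul, Matrix.smul_apply,
    Matrix.of_apply, Matrix.cons_val_zero, Matrix.cons_val_one, Function.comp_apply,
    Matrix.cons_val', Matrix.cons_val_fin_one, e00, e01, e10, e11]
  generalize (bilJac b c d x).det = D at hd hJ ⊢
  field_simp
  rw [hd]
  ring

/-! ### Reference elements -/

/-- The closed reference element. -/
def closedRef : Shape → Set Plane
  | .tri => {x | 0 ≤ x 0 ∧ 0 ≤ x 1 ∧ x 0 + x 1 ≤ 1}
  | .quad => {x | -1 ≤ x 0 ∧ x 0 ≤ 1 ∧ -1 ≤ x 1 ∧ x 1 ≤ 1}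

lemma continuous_coord (i : Fin 2) : Continuous fun x : Plane => x i := by fun_prop

lemma isOpen_refElem (s : Shape) : IsOpen (refElem s) := by
  have h0 := continuous_coord 0
  have h1 := continuous_coord 1
  cases s
  · exact (isOpen_lt continuous_const h0).inter ((isOpen_lt continuous_const h1).inter
      (isOpen_lt (h0.add h1) continuous_const))
  · exact (isOpen_lt continuous_const h0).inter ((isOpen_lt h0 continuous_const).inter
      ((isOpen_lt continuous_const h1).inter (isOpen_lt h1 continuous_const)))

lemma isClosed_closedRef (s : Shape) : IsClosed (closedRef s) := by
  have h0 := continuous_coord 0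
  have h1 := continuous_coord 1
  cases s
  · exact (isClosed_le continuous_const h0).inter ((isClosed_le continuous_const h1).inter
      (isClosed_le (h0.add h1) continuous_const))
  · exact (isClosed_le continuous_const h0).inter ((isClosed_le h0 continuous_const).inter
      ((isClosed_le continuous_const h1).inter (isClosed_le h1 continuous_const)))

lemma closure_refElem (s : Shape) : closure (refElem s) = closedRef s := by
  apply subset_antisymm
  · refine closure_minimal ?_ (isClosed_closedRef s)
    cases s
    · exact fun x hx => ⟨hx.1.le, hx.2.1.le, hx.2.2.le⟩
    · exact fun x hx => ⟨hx.1.le, hx.2.1.le, hx.2.2.1.le, hx.2.2.2.le⟩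
  · -- move a boundary point towards an interior one
    intro x hx
    have key : ∀ z : Plane, (∀ t ∈ Set.Ioo (0 : ℝ) 1, AffineMap.lineMap x z t ∈ refElem s) →
        x ∈ closure (refElem s) := by
      intro z hz
      have hc : Filter.Tendsto (fun t : ℝ => (AffineMap.lineMap x z t : Plane))
          (nhdsWithin 0 (Set.Ioi 0)) (nhds x) := by
        have : Continuous fun t : ℝ => (AffineMap.lineMap x z t : Plane) :=
          AffineMap.lineMap_continuous
        simpa using (this.tendsto 0).mono_left nhdsWithin_le_nhds
      exact mem_closure_of_tendsto hc
        (Filter.mem_of_superset (Ioo_mem_nhdsGT one_pos) fun t ht => hz t ht)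
    cases s
    · refine key !₂[1 / 3, 1 / 3] fun t ht => ?_
      obtain ⟨h0, h1, h2⟩ := hx
      obtain ⟨t0, t1⟩ := ht
      simp only [AffineMap.lineMap_apply_module, refElem, Set.mem_ofPred_eq, PiLp.add_apply,
        PiLp.smul_apply, smul_eq_mul, Matrix.cons_val_zero, Matrix.cons_val_one]
      refine ⟨?_, ?_, ?_⟩ <;> nlinarith
    · refine key 0 fun t ht => ?_
      obtain ⟨h0, h1, h2, h3⟩ := hx
      obtain ⟨t0, t1⟩ := ht
      simp only [AffineMap.lineMap_apply_module, refElem, Set.mem_ofPred_eq, PiLp.add_apply,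
        PiLp.smul_apply, smul_eq_mul, PiLp.zero_apply]
      refine ⟨?_, ?_, ?_, ?_⟩ <;> nlinarith

lemma convex_closedRef (s : Shape) : Convex ℝ (closedRef s) := by
  intro x hx y hy α β hα hβ hαβ
  obtain rfl : β = 1 - α := by linarith
  cases s
  · obtain ⟨h0, h1, h2⟩ := hx
    obtain ⟨k0, k1, k2⟩ := hy
    simp only [closedRef, Set.mem_ofPred_eq, PiLp.add_apply, PiLp.smul_apply, smul_eq_mul]
    refine ⟨?_, ?_, ?_⟩ <;> nlinarith
  · obtain ⟨h0, h1, h2, h3⟩ := hx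
    obtain ⟨k0, k1, k2, k3⟩ := hy
    simp only [closedRef, Set.mem_ofPred_eq, PiLp.add_apply, PiLp.smul_apply, smul_eq_mul]
    refine ⟨?_, ?_, ?_, ?_⟩ <;> nlinarith

lemma isCompact_closure_refElem (s : Shape) : IsCompact (closure (refElem s)) := by
  rw [closure_refElem]
  refine Metric.isCompact_of_isClosed_isBounded (isClosed_closedRef s) ?_
  refine (Metric.isBounded_closedBall (x := (0 : Plane)) (r := 2)).subset fun x hx => ?_
  rw [mem_closedBall_zero_iff, EuclideanSpace.norm_eq]
  refine Real.sqrt_le_iff.2 ⟨by norm_num, ?_⟩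
  simp only [Fin.sum_univ_two, Real.norm_eq_abs, sq_abs]
  cases s
  · obtain ⟨h0, h1, h2⟩ := hx
    nlinarith
  · obtain ⟨h0, h1, h2, h3⟩ := hx
    nlinarith

lemma refVert_mem (s : Shape) (i : Fin s.n) : refVert s i ∈ closure (refElem s) := by
  rw [closure_refElem]
  cases s
  · change Fin 3 at i
    fin_cases i <;> simp [refVert, closedRef]
  · change Fin 4 at i
    fin_cases i <;> simp [refVert, closedRef]

/-- A point of the `i`-th edge of the reference element. -/
noncomputable def refEdge (s : Shape) (i : Fin s.n) (t : ℝ) : Plane :=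
  AffineMap.lineMap (refVert s i) (refVert s (i + 1)) t

lemma refEdge_mem (s : Shape) (i : Fin s.n) {t : ℝ} (ht : t ∈ Set.Icc (0 : ℝ) 1) :
    refEdge s i t ∈ closure (refElem s) := by
  have h1 := refVert_mem s i
  have h2 := refVert_mem s (i + 1)
  rw [closure_refElem] at *
  exact (convex_closedRef s).lineMap_mem h1 h2 ht

lemma continuous_refEdge (s : Shape) (i : Fin s.n) : Continuous (refEdge s i) :=
  AffineMap.lineMap_continuous

lemma refEdge_apply (s : Shape) (i : Fin s.n) (t : ℝ) (k : Fin 2) :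
    refEdge s i t k = refVert s i k + t * (refVert s (i + 1) - refVert s i) k := by
  simp [refEdge, AffineMap.lineMap_apply_module]; ring

/-! ### The element map -/

/-- Both kinds of element maps are of the form `bil a b c d`; the bilinear term is absent for
triangles. -/
lemma refMap_eq_bil (s : Shape) (V : Fin s.n → Plane) :
    ∃ a b c d, refMap s V = bil a b c d ∧ (s = .tri → d = 0) := by
  cases s
  · let W : Fin 3 → Plane := V
    refine ⟨W 0, W 1 - W 0, W 2 - W 0, 0, ?_, fun _ => rfl⟩
    ext x i
    simp [refMap, bil, W]
    ring
  · let W : Fin 4 → Plane := V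
    refine ⟨(1 / 4 : ℝ) • (W 0 + W 1 + W 2 + W 3), (1 / 4 : ℝ) • (-W 0 + W 1 + W 2 - W 3),
      (1 / 4 : ℝ) • (-W 0 - W 1 + W 2 + W 3), (1 / 4 : ℝ) • (W 0 - W 1 + W 2 - W 3), ?_, by simp⟩
    ext x i
    simp [refMap, bil, W]
    ring

lemma jac_refMap_tri (V : Fin Shape.tri.n → Plane) (x : Plane) :
    let W : Fin 3 → Plane := V
    jac (refMap .tri V) x =
      !![W 1 0 - W 0 0, W 2 0 - W 0 0; W 1 1 - W 0 1, W 2 1 - W 0 1] := by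
  intro W
  have : refMap .tri V = bil (W 0) (W 1 - W 0) (W 2 - W 0) 0 := by
    ext x i
    simp [refMap, bil, W]
    ring
  rw [this, jac_bil]
  simp [bilJac]

lemma jac_refMap_quad (V : Fin Shape.quad.n → Plane) (x : Plane) :
    let W : Fin 4 → Plane := V
    jac (refMap .quad V) x = Matrix.of fun i => (![
      ((1 - x 1) * (W 1 i - W 0 i) + (1 + x 1) * (W 2 i - W 3 i)) / 4,
      ((1 - x 0) * (W 3 i - W 0 i) + (1 + x 0) * (W 2 i - W 1 i)) / 4] : Fin 2 → ℝ) := by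
  intro W
  have : refMap .quad V = bil ((1 / 4 : ℝ) • (W 0 + W 1 + W 2 + W 3))
      ((1 / 4 : ℝ) • (-W 0 + W 1 + W 2 - W 3)) ((1 / 4 : ℝ) • (-W 0 - W 1 + W 2 + W 3))
      ((1 / 4 : ℝ) • (W 0 - W 1 + W 2 - W 3)) := by
    ext x i
    simp [refMap, bil, W]
    ring
  rw [this, jac_bil]
  ext i j
  fin_cases i <;> fin_cases j <;> simp [bilJac] <;> ring

/-- Convexity of the element makes the Jacobian positive on the closed reference element: it is
an interpolation of its vertex values, which are the vector products of consecutive edges. -/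
lemma jac_refMap_det_pos {s : Shape} {V : Fin s.n → Plane} (hV : IsConvexPolygon s V)
    {x : Plane} (hx : x ∈ closure (refElem s)) : 0 < (jac (refMap s V) x).det := by
  rw [closure_refElem] at hx
  cases s
  · let W : Fin 3 → Plane := V
    have h : 0 < cross (W 1 - W 0) (W 2 - W 1) := hV (0 : Fin 3)
    rw [jac_refMap_tri, Matrix.det_fin_two_of]
    simp only [cross, PiLp.sub_apply] at h
    change 0 < (W 1 0 - W 0 0) * (W 2 1 - W 0 1) - (W 2 0 - W 0 0) * (W 1 1 - W 0 1)
    linarith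
  · let W : Fin 4 → Plane := V
    have h1 : 0 < cross (W 1 - W 0) (W 2 - W 1) := hV (0 : Fin 4)
    have h2 : 0 < cross (W 2 - W 1) (W 3 - W 2) := hV (1 : Fin 4)
    have h3 : 0 < cross (W 3 - W 2) (W 0 - W 3) := hV (2 : Fin 4)
    have h0 : 0 < cross (W 0 - W 3) (W 1 - W 0) := hV (3 : Fin 4)
    obtain ⟨k0, k1, k2, k3⟩ := hx
    have a0 : 0 ≤ 1 + x 0 := by linarith
    have a1 : 0 ≤ 1 - x 0 := by linarith
    have b0 : 0 ≤ 1 + x 1 := by linarith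
    have b1 : 0 ≤ 1 - x 1 := by linarith
    have hdet : 16 * (jac (refMap .quad V) x).det =
        (1 - x 0) * (1 - x 1) * cross (W 0 - W 3) (W 1 - W 0) +
        (1 + x 0) * (1 - x 1) * cross (W 1 - W 0) (W 2 - W 1) +
        (1 + x 0) * (1 + x 1) * cross (W 2 - W 1) (W 3 - W 2) +
        (1 - x 0) * (1 + x 1) * cross (W 3 - W 2) (W 0 - W 3) := by
      rw [jac_refMap_quad, Matrix.det_fin_two]
      simp [cross, W]
      ring
    obtain ⟨m, hm, m0, m1, m2, m3⟩ : ∃ m : ℝ, 0 < m ∧ m ≤ cross (W 0 - W 3) (W 1 - W 0) ∧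
        m ≤ cross (W 1 - W 0) (W 2 - W 1) ∧ m ≤ cross (W 2 - W 1) (W 3 - W 2) ∧
        m ≤ cross (W 3 - W 2) (W 0 - W 3) :=
      ⟨min (min _ _) (min _ _), lt_min (lt_min h0 h1) (lt_min h2 h3),
        (min_le_left _ _).trans (min_le_left _ _), (min_le_left _ _).trans (min_le_right _ _),
        (min_le_right _ _).trans (min_le_left _ _), (min_le_right _ _).trans (min_le_right _ _)⟩
    have e0 := mul_le_mul_of_nonneg_left m0 (mul_nonneg a1 b1)
    have e1 := mul_le_mul_of_nonneg_left m1 (mul_nonneg a0 b1)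
    have e2 := mul_le_mul_of_nonneg_left m2 (mul_nonneg a0 b0)
    have e3 := mul_le_mul_of_nonneg_left m3 (mul_nonneg a1 b0)
    linarith

lemma refMap_injOn {s : Shape} {V : Fin s.n → Plane} (hV : IsConvexPolygon s V) :
    Set.InjOn (refMap s V) (closure (refElem s)) := by
  obtain ⟨a, b, c, d, h, -⟩ := refMap_eq_bil s V
  have hJ : ∀ x ∈ closure (refElem s), 0 < (jac (refMap s V) x).det :=
    fun x hx => jac_refMap_det_pos hV hx
  rw [h] at hJ ⊢
  simp only [jac_bil] at hJ
  refine bil_injOn a b c d ?_ fun x hx => (hJ x hx).ne'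
  rw [closure_refElem]
  exact convex_closedRef s

lemma refEdge_tri (i : Fin 3) (t : ℝ) :
    refEdge .tri i t = (![!₂[t, 0], !₂[1 - t, t], !₂[0, 1 - t]] : Fin 3 → Plane) i := by
  ext k
  refine (refEdge_apply .tri i t k).trans ?_
  fin_cases i
  · change (!₂[0, 0] : Plane) k + t * ((!₂[1, 0] - !₂[0, 0] : Plane) k) = (!₂[t, 0] : Plane) k
    fin_cases k <;> simp
  · change (!₂[1, 0] : Plane) k + t * ((!₂[0, 1] - !₂[1, 0] : Plane) k) = (!₂[1 - t, t] : Plane) k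
    fin_cases k <;> simp
    ring
  · change (!₂[0, 1] : Plane) k + t * ((!₂[0, 0] - !₂[0, 1] : Plane) k) = (!₂[0, 1 - t] : Plane) k
    fin_cases k <;> simp
    ring

lemma refEdge_quad (i : Fin 4) (t : ℝ) :
    refEdge .quad i t = (![!₂[2 * t - 1, -1], !₂[1, 2 * t - 1], !₂[1 - 2 * t, 1],
      !₂[-1, 1 - 2 * t]] : Fin 4 → Plane) i := by
  ext k
  refine (refEdge_apply .quad i t k).trans ?_
  fin_cases i
  · change (!₂[-1, -1] : Plane) k + t * ((!₂[1, -1] - !₂[-1, -1] : Plane) k) =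
      (!₂[2 * t - 1, -1] : Plane) k
    fin_cases k <;> simp
    ring
  · change (!₂[1, -1] : Plane) k + t * ((!₂[1, 1] - !₂[1, -1] : Plane) k) =
      (!₂[1, 2 * t - 1] : Plane) k
    fin_cases k <;> simp
    ring
  · change (!₂[1, 1] : Plane) k + t * ((!₂[-1, 1] - !₂[1, 1] : Plane) k) =
      (!₂[1 - 2 * t, 1] : Plane) k
    fin_cases k <;> simp
    ring
  · change (!₂[-1, 1] : Plane) k + t * ((!₂[-1, -1] - !₂[-1, 1] : Plane) k) =
      (!₂[-1, 1 - 2 * t] : Plane) k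
    fin_cases k <;> simp
    ring

/-- The element map is affine on each edge. -/
lemma refMap_refEdge (s : Shape) (V : Fin s.n → Plane) (i : Fin s.n) (t : ℝ) :
    refMap s V (refEdge s i t) = AffineMap.lineMap (V i) (V (i + 1)) t := by
  cases s
  · change Fin 3 at i
    let W : Fin 3 → Plane := V
    change refMap .tri W _ = AffineMap.lineMap (W i) (W (i + 1)) t
    rw [refEdge_tri]
    ext k
    fin_cases i <;> simp [refMap, AffineMap.lineMap_apply_module, add_comm]
  · change Fin 4 at i
    let W : Fin 4 → Plane := V
    change refMap .quad W _ = AffineMap.lineMap (W i) (W (i + 1)) t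
    rw [refEdge_quad]
    ext k
    fin_cases i <;> simp [refMap, AffineMap.lineMap_apply_module] <;> ring

/-- The Jacobian of the element map takes the edges of the reference element to those of the
element. -/
lemma jac_refMap_edge (s : Shape) (V : Fin s.n → Plane) (i : Fin s.n) (t : ℝ) (k : Fin 2) :
    ∑ j, jac (refMap s V) (refEdge s i t) k j * (refVert s (i + 1) - refVert s i) j =
      (V (i + 1) - V i) k := by
  obtain ⟨a, b, c, d, h, -⟩ := refMap_eq_bil s V
  have h1 : HasDerivAt (fun t : ℝ => refMap s V (refEdge s i t)) (V (i + 1) - V i) t := by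
    simp only [refMap_refEdge]
    exact AffineMap.hasDerivAt_lineMap
  have h2 : HasDerivAt (refEdge s i) (refVert s (i + 1) - refVert s i) t :=
    AffineMap.hasDerivAt_lineMap
  rw [h] at h1 ⊢
  have h3 := (hasStrictFDerivAt_bil a b c d (refEdge s i t)).hasFDerivAt.comp_hasDerivAt t h2
  rw [h1.unique h3, bilDeriv_apply, jac_bil]

/-! ### Divergence theorem on the reference elements -/

/-- Fubini's theorem on a region of the plane lying between two graphs over `Ioo α β`, in
coordinates given by a measure-preserving equivalence with `ℝ × ℝ`. -/
lemma setIntegral_between (φ : ℝ × ℝ ≃ᵐ Plane) (hφ : MeasurePreserving φ) {α β : ℝ}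
    (hαβ : α ≤ β) {lo hi : ℝ → ℝ} (hlo : Continuous lo) (hhi : Continuous hi)
    (hlh : ∀ t ∈ Set.Ioo α β, lo t ≤ hi t) {S : Set Plane}
    (hS : φ ⁻¹' S = regionBetween lo hi (Set.Ioo α β)) {g : Plane → ℝ} (hg : IntegrableOn g S) :
    ∫ x in S, g x = ∫ t in α..β, ∫ u in lo t..hi t, g (φ (t, u)) := by
  have hR : MeasurableSet (regionBetween lo hi (Set.Ioo α β)) :=
    measurableSet_regionBetween hlo.measurable hhi.measurable measurableSet_Ioo
  have hg' : IntegrableOn (g ∘ φ) (regionBetween lo hi (Set.Ioo α β)) := by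
    rw [← hS]
    exact (hφ.integrableOn_comp_preimage φ.measurableEmbedding).2 hg
  rw [← hφ.setIntegral_preimage_emb φ.measurableEmbedding, hS, ← integral_indicator hR,
    Measure.volume_eq_prod, integral_prod, intervalIntegral.integral_of_le hαβ,
    integral_Ioc_eq_integral_Ioo, ← integral_indicator measurableSet_Ioo]
  · refine integral_congr_ae (Filter.Eventually.of_forall fun t => ?_)
    by_cases ht : t ∈ Set.Ioo α β
    · simp only [Set.indicator_of_mem ht]
      rw [intervalIntegral.integral_of_le (hlh t ht), integral_Ioc_eq_integral_Ioo,
        ← integral_indicator measurableSet_Ioo]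
      refine integral_congr_ae (Filter.Eventually.of_forall fun u => ?_)
      by_cases hu : u ∈ Set.Ioo (lo t) (hi t)
      · simp only [Set.indicator_of_mem hu]
        exact Set.indicator_of_mem (show (t, u) ∈ regionBetween lo hi _ from ⟨ht, hu⟩) _
      · simp only [Set.indicator_of_notMem hu]
        exact Set.indicator_of_notMem (fun h => hu h.2) _
    · simp only [Set.indicator_of_notMem ht]
      rw [← integral_zero ℝ ℝ]
      refine integral_congr_ae (Filter.Eventually.of_forall fun u => ?_)
      exact Set.indicator_of_notMem (fun h => ht h.1) _
  · rw [← Measure.volume_eq_prod]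
    exact (integrable_indicator_iff hR).2 hg'

/-- Cartesian coordinates as a measurable equivalence. -/
noncomputable def planeEquiv : ℝ × ℝ ≃ᵐ Plane :=
  MeasurableEquiv.finTwoArrow.symm.trans (MeasurableEquiv.toLp 2 (Fin 2 → ℝ))

lemma measurePreserving_planeEquiv : MeasurePreserving planeEquiv :=
  ((volume_preserving_finTwoArrow ℝ).symm _).trans
    (EuclideanSpace.volume_preserving_symm_measurableEquiv_toLp (Fin 2)).symm

lemma measurePreserving_planeEquiv_swap :
    MeasurePreserving (MeasurableEquiv.prodComm.trans planeEquiv) :=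
  (Measure.measurePreserving_swap (μ := (volume : Measure ℝ)) (ν := (volume : Measure ℝ))).trans
    measurePreserving_planeEquiv

lemma hasDerivAt_pev_snd (p : Poly) (t u : ℝ) :
    HasDerivAt (fun u : ℝ => pev p !₂[t, u]) (pev (MvPolynomial.pderiv 1 p) !₂[t, u]) u := by
  have h : HasDerivAt (fun u : ℝ => (!₂[t, u] : Plane)) (e 1) u := by
    have : (fun u : ℝ => (!₂[t, u] : Plane)) = fun u => t • e 0 + u • e 1 := by
      ext u i; fin_cases i <;> simp [e]
    rw [this]
    simpa using ((hasDerivAt_id u).smul_const (e 1)).const_add (t • e 0)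
  have := (hasFDerivAt_pev p !₂[t, u]).comp_hasDerivAt u h
  exact this.congr_deriv (by simp [Fin.sum_univ_two, e])

lemma hasDerivAt_pev_fst (p : Poly) (t u : ℝ) :
    HasDerivAt (fun u : ℝ => pev p !₂[u, t]) (pev (MvPolynomial.pderiv 0 p) !₂[u, t]) u := by
  have h : HasDerivAt (fun u : ℝ => (!₂[u, t] : Plane)) (e 0) u := by
    have : (fun u : ℝ => (!₂[u, t] : Plane)) = fun u => t • e 1 + u • e 0 := by
      ext u i; fin_cases i <;> simp [e]
    rw [this]
    simpa using ((hasDerivAt_id u).smul_const (e 0)).const_add (t • e 1)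
  have := (hasFDerivAt_pev p !₂[u, t]).comp_hasDerivAt u h
  exact this.congr_deriv (by simp [Fin.sum_univ_two, e])

lemma integrableOn_refElem {s : Shape} {g : Plane → ℝ}
    (hg : ContinuousOn g (closure (refElem s))) : IntegrableOn g (refElem s) :=
  (hg.integrableOn_compact (isCompact_closure_refElem s)).mono_set subset_closure

/-- Divergence theorem on a reference element that is the region between the same two graphs in
either order of the coordinates. -/
lemma integral_pderiv_refElem {s : Shape} {α β : ℝ} (hαβ : α ≤ β) {lo hi : ℝ → ℝ}
    (hlo : Continuous lo) (hhi : Continuous hi) (hlh : ∀ t ∈ Set.Ioo α β, lo t ≤ hi t)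
    (h0 : ∀ x : Plane, x ∈ refElem s ↔ x 0 ∈ Set.Ioo α β ∧ x 1 ∈ Set.Ioo (lo (x 0)) (hi (x 0)))
    (h1 : ∀ x : Plane, x ∈ refElem s ↔ x 1 ∈ Set.Ioo α β ∧ x 0 ∈ Set.Ioo (lo (x 1)) (hi (x 1)))
    (p : Fin 2 → Poly) :
    ∫ x in refElem s, ∑ j, pev (MvPolynomial.pderiv j (p j)) x =
      (∫ t in α..β, (pev (p 0) !₂[hi t, t] - pev (p 0) !₂[lo t, t])) +
      ∫ t in α..β, (pev (p 1) !₂[t, hi t] - pev (p 1) !₂[t, lo t]) := by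
  have hint : ∀ q : Poly, IntegrableOn (pev q) (refElem s) := fun q =>
    integrableOn_refElem (continuous_pev q).continuousOn
  simp only [Fin.sum_univ_two]
  rw [integral_add (hint _) (hint _)]
  congr 1
  · rw [setIntegral_between (S := refElem s) _ measurePreserving_planeEquiv_swap hαβ hlo hhi hlh
      (Set.ext fun q => h1 _) (hint _)]
    refine intervalIntegral.integral_congr fun t _ => ?_
    refine intervalIntegral.integral_eq_sub_of_hasDerivAt
      (fun u _ => hasDerivAt_pev_fst (p 0) t u) ?_
    refine Continuous.intervalIntegrable ((continuous_pev _).comp ?_) _ _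
    fun_prop
  · rw [setIntegral_between (S := refElem s) _ measurePreserving_planeEquiv hαβ hlo hhi hlh
      (Set.ext fun q => h0 _) (hint _)]
    refine intervalIntegral.integral_congr fun t _ => ?_
    refine intervalIntegral.integral_eq_sub_of_hasDerivAt
      (fun u _ => hasDerivAt_pev_snd (p 1) t u) ?_
    refine Continuous.intervalIntegrable ((continuous_pev _).comp ?_) _ _
    fun_prop

lemma refVert_sub_tri (i : Fin 3) :
    refVert .tri (i + 1 : Fin 3) - refVert .tri i =
      (![!₂[1, 0], !₂[-1, 1], !₂[0, -1]] : Fin 3 → Plane) i := by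
  fin_cases i
  · change (!₂[1, 0] : Plane) - !₂[0, 0] = !₂[1, 0]
    ext k; fin_cases k <;> simp
  · change (!₂[0, 1] : Plane) - !₂[1, 0] = !₂[-1, 1]
    ext k; fin_cases k <;> simp
  · change (!₂[0, 0] : Plane) - !₂[0, 1] = !₂[0, -1]
    ext k; fin_cases k <;> simp

lemma refVert_sub_quad (i : Fin 4) :
    refVert .quad (i + 1 : Fin 4) - refVert .quad i =
      (![!₂[2, 0], !₂[0, 2], !₂[-2, 0], !₂[0, -2]] : Fin 4 → Plane) i := by
  fin_cases i
  · change (!₂[1, -1] : Plane) - !₂[-1, -1] = !₂[2, 0]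
    ext k; fin_cases k <;> norm_num
  · change (!₂[1, 1] : Plane) - !₂[1, -1] = !₂[0, 2]
    ext k; fin_cases k <;> norm_num
  · change (!₂[-1, 1] : Plane) - !₂[1, 1] = !₂[-2, 0]
    ext k; fin_cases k <;> norm_num
  · change (!₂[-1, -1] : Plane) - !₂[-1, 1] = !₂[0, -2]
    ext k; fin_cases k <;> norm_num

/-- The divergence theorem for polynomial fields on the reference elements. -/
lemma divergence_refElem (s : Shape) (p : Fin 2 → Poly) :
    ∫ x in refElem s, ∑ j, pev (MvPolynomial.pderiv j (p j)) x =
      ∑ i, ∫ t in (0 : ℝ)..1,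
        (pev (p 0) (refEdge s i t) * (refVert s (i + 1) - refVert s i) 1 -
          pev (p 1) (refEdge s i t) * (refVert s (i + 1) - refVert s i) 0) := by
  have hc : ∀ (q : Poly) {γ : ℝ → Plane}, Continuous γ → ∀ α β : ℝ,
      IntervalIntegrable (fun t => pev q (γ t)) volume α β := fun q γ hγ α β =>
    ((continuous_pev q).comp hγ).intervalIntegrable _ _
  cases s
  · rw [integral_pderiv_refElem (s := .tri) zero_le_one (lo := fun _ => 0) (hi := fun t => 1 - t)
      continuous_const (by fun_prop) (fun t ht => by linarith [ht.2])
      (fun x => ⟨fun h => ⟨⟨h.1, by linarith [h.2.1, h.2.2]⟩, h.2.1, by linarith [h.2.2]⟩,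
        fun h => ⟨h.1.1, h.2.1, by linarith [h.2.2]⟩⟩)
      (fun x => ⟨fun h => ⟨⟨h.2.1, by linarith [h.1, h.2.2]⟩, h.1, by linarith [h.2.2]⟩,
        fun h => ⟨h.2.1, h.1.1, by linarith [h.2.2]⟩⟩)]
    change _ = ∑ i : Fin 3, ∫ t in (0 : ℝ)..1,
        (pev (p 0) (refEdge .tri i t) * (refVert .tri (i + 1 : Fin 3) - refVert .tri i) 1 -
          pev (p 1) (refEdge .tri i t) * (refVert .tri (i + 1 : Fin 3) - refVert .tri i) 0)
    simp only [refEdge_tri, refVert_sub_tri]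
    rw [Fin.sum_univ_three]
    simp
    rw [intervalIntegral.integral_sub (hc _ (by fun_prop) _ _) (hc _ (by fun_prop) _ _),
      intervalIntegral.integral_sub (hc _ (by fun_prop) _ _) (hc _ (by fun_prop) _ _),
      intervalIntegral.integral_add (hc _ (by fun_prop) _ _) (hc _ (by fun_prop) _ _)]
    have k1 := intervalIntegral.integral_comp_sub_left (a := 0) (b := 1)
      (fun t : ℝ => pev (p 1) !₂[1 - t, t]) 1
    have k0 := intervalIntegral.integral_comp_sub_left (a := 0) (b := 1)
      (fun t : ℝ => pev (p 0) !₂[0, t]) 1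
    simp only [sub_sub_cancel, sub_self, sub_zero] at k1 k0
    linarith
  · rw [integral_pderiv_refElem (s := .quad) (α := -1) (β := 1) (by norm_num)
      (lo := fun _ => -1) (hi := fun _ => 1)
      continuous_const continuous_const (fun t ht => by norm_num)
      (fun x => ⟨fun h => ⟨⟨h.1, h.2.1⟩, h.2.2⟩, fun h => ⟨h.1.1, h.1.2, h.2⟩⟩)
      (fun x => ⟨fun h => ⟨h.2.2, h.1, h.2.1⟩, fun h => ⟨h.2.1, h.2.2, h.1⟩⟩)]
    change _ = ∑ i : Fin 4, ∫ t in (0 : ℝ)..1,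
        (pev (p 0) (refEdge .quad i t) * (refVert .quad (i + 1 : Fin 4) - refVert .quad i) 1 -
          pev (p 1) (refEdge .quad i t) * (refVert .quad (i + 1 : Fin 4) - refVert .quad i) 0)
    simp only [refEdge_quad, refVert_sub_quad]
    rw [Fin.sum_univ_four]
    simp
    rw [intervalIntegral.integral_sub (hc _ (by fun_prop) _ _) (hc _ (by fun_prop) _ _),
      intervalIntegral.integral_sub (hc _ (by fun_prop) _ _) (hc _ (by fun_prop) _ _)]
    have k0 := intervalIntegral.smul_integral_comp_mul_sub (a := 0) (b := 1)
      (fun t : ℝ => pev (p 1) !₂[t, -1]) 2 1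
    have k1 := intervalIntegral.smul_integral_comp_mul_sub (a := 0) (b := 1)
      (fun t : ℝ => pev (p 0) !₂[1, t]) 2 1
    have k2 := intervalIntegral.smul_integral_comp_sub_mul (a := 0) (b := 1)
      (fun t : ℝ => pev (p 1) !₂[t, 1]) 2 1
    have k3 := intervalIntegral.smul_integral_comp_sub_mul (a := 0) (b := 1)
      (fun t : ℝ => pev (p 0) !₂[-1, t]) 2 1
    norm_num at k0 k1 k2 k3
    linarith

/-! ### Polynomial spaces -/

lemma mono_eq_monomial (i j : ℕ) :
    mono i j = MvPolynomial.monomial (Finsupp.single 0 i + Finsupp.single 1 j) 1 := by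
  rw [mono, MvPolynomial.X_pow_eq_monomial, MvPolynomial.X_pow_eq_monomial,
    MvPolynomial.monomial_mul, one_mul]

lemma totalDegree_mono_le (i j : ℕ) : (mono i j).totalDegree ≤ i + j := by
  refine (MvPolynomial.totalDegree_mul _ _).trans (add_le_add ?_ ?_) <;>
  · rw [MvPolynomial.totalDegree_X_pow]

lemma polyP_eq_span (r : ℕ) :
    polyP r = Submodule.span ℝ {p | ∃ i j, i + j ≤ r ∧ p = mono i j} := by
  apply le_antisymm
  · intro p hp
    rw [polyP, MvPolynomial.mem_restrictTotalDegree] at hp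
    rw [p.as_sum]
    refine Submodule.sum_mem _ fun n hn => ?_
    have hn' : n 0 + n 1 ≤ r := by
      refine le_trans ?_ ((MvPolynomial.le_totalDegree hn).trans hp)
      rw [Finsupp.sum_fintype _ _ (fun _ => rfl), Fin.sum_univ_two]
    have : MvPolynomial.monomial n (p.coeff n) = p.coeff n • mono (n 0) (n 1) := by
      rw [mono_eq_monomial, MvPolynomial.smul_monomial, smul_eq_mul, mul_one]
      have : n = Finsupp.single 0 (n 0) + Finsupp.single 1 (n 1) := by
        refine Finsupp.ext fun k => ?_
        fin_cases k <;> simp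
      rw [← this]
    rw [this]
    exact Submodule.smul_mem _ _ (Submodule.subset_span ⟨_, _, hn', rfl⟩)
  · rw [Submodule.span_le]
    rintro _ ⟨i, j, hij, rfl⟩
    exact (MvPolynomial.mem_restrictTotalDegree _ _ _).2 ((totalDegree_mono_le i j).trans hij)

lemma mem_polyP {r : ℕ} {p : Poly} : p ∈ polyP r ↔ p.totalDegree ≤ r :=
  MvPolynomial.mem_restrictTotalDegree _ _ _

lemma polyP_mono {a b : ℕ} (h : a ≤ b) : polyP a ≤ polyP b := fun _ hp =>
  mem_polyP.2 ((mem_polyP.1 hp).trans h)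

lemma polyPP_mono {a b a' b' : ℕ} (ha : a ≤ a') (hb : b ≤ b') : polyPP a b ≤ polyPP a' b' :=
  Submodule.span_mono fun _ ⟨i, j, hi, hj, h⟩ => ⟨i, j, hi.trans ha, hj.trans hb, h⟩

lemma pderiv_zero_mono (i j : ℕ) :
    MvPolynomial.pderiv 0 (mono i j) = (i : ℝ) • mono (i - 1) j := by
  simp [mono, Derivation.leibniz, Derivation.leibniz_pow, MvPolynomial.pderiv_X,
    MvPolynomial.smul_eq_C_mul]
  ring

lemma pderiv_one_mono (i j : ℕ) :
    MvPolynomial.pderiv 1 (mono i j) = (j : ℝ) • mono i (j - 1) := by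
  simp [mono, Derivation.leibniz, Derivation.leibniz_pow, MvPolynomial.pderiv_X,
    MvPolynomial.smul_eq_C_mul]
  ring

lemma pderiv_mem_polyP {r : ℕ} {p : Poly} (hp : p ∈ polyP r) (k : Fin 2) :
    MvPolynomial.pderiv k p ∈ polyP (r - 1) := by
  rw [polyP_eq_span] at hp
  have : Submodule.span ℝ {p | ∃ i j, i + j ≤ r ∧ p = mono i j} ≤
      (polyP (r - 1)).comap (MvPolynomial.pderiv (R := ℝ) k).toLinearMap := by
    rw [Submodule.span_le]
    rintro _ ⟨i, j, hij, rfl⟩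
    change MvPolynomial.pderiv k (mono i j) ∈ polyP (r - 1)
    fin_cases k
    · change MvPolynomial.pderiv 0 (mono i j) ∈ _
      rw [pderiv_zero_mono]
      rcases Nat.eq_zero_or_pos i with rfl | hi
      · simp
      · exact Submodule.smul_mem _ _ (mem_polyP.2 ((totalDegree_mono_le _ _).trans (by omega)))
    · change MvPolynomial.pderiv 1 (mono i j) ∈ _
      rw [pderiv_one_mono]
      rcases Nat.eq_zero_or_pos j with rfl | hj
      · simp
      · exact Submodule.smul_mem _ _ (mem_polyP.2 ((totalDegree_mono_le _ _).trans (by omega)))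
  exact this hp

lemma pderiv_zero_mem_polyPP {a b : ℕ} {p : Poly} (hp : p ∈ polyPP a b) :
    MvPolynomial.pderiv 0 p ∈ polyPP (a - 1) b := by
  have : polyPP a b ≤
      (polyPP (a - 1) b).comap (MvPolynomial.pderiv (R := ℝ) (0 : Fin 2)).toLinearMap := by
    rw [polyPP, Submodule.span_le]
    rintro _ ⟨i, j, hi, hj, rfl⟩
    change MvPolynomial.pderiv 0 (mono i j) ∈ polyPP (a - 1) b
    rw [pderiv_zero_mono]
    exact Submodule.smul_mem _ _ (Submodule.subset_span ⟨_, _, by omega, hj, rfl⟩)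
  exact this hp

lemma pderiv_one_mem_polyPP {a b : ℕ} {p : Poly} (hp : p ∈ polyPP a b) :
    MvPolynomial.pderiv 1 p ∈ polyPP a (b - 1) := by
  have : polyPP a b ≤
      (polyPP a (b - 1)).comap (MvPolynomial.pderiv (R := ℝ) (1 : Fin 2)).toLinearMap := by
    rw [polyPP, Submodule.span_le]
    rintro _ ⟨i, j, hi, hj, rfl⟩
    change MvPolynomial.pderiv 1 (mono i j) ∈ polyPP a (b - 1)
    rw [pderiv_one_mono]
    exact Submodule.smul_mem _ _ (Submodule.subset_span ⟨_, _, hi, by omega, rfl⟩)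
  exact this hp

lemma pev_aeval (L : Fin 2 → Poly) (p : Poly) (y : Plane) :
    pev (MvPolynomial.aeval L p) y = pev p (WithLp.toLp 2 fun k => pev (L k) y) := by
  induction p using MvPolynomial.induction_on with
  | C t => simp [pev]
  | add p q hp hq => rw [map_add, pev_add, pev_add, hp, hq]
  | mul_X p i hp => rw [map_mul, pev_mul, pev_mul, hp, MvPolynomial.aeval_X, pev_X]

lemma aeval_mono (L : Fin 2 → Poly) (i j : ℕ) :
    MvPolynomial.aeval L (mono i j) = L 0 ^ i * L 1 ^ j := by
  simp [mono]

lemma totalDegree_pow_le {p : Poly} {k : ℕ} (hp : p.totalDegree ≤ k) (n : ℕ) :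
    (p ^ n).totalDegree ≤ n * k :=
  (MvPolynomial.totalDegree_pow _ _).trans (Nat.mul_le_mul_left n hp)

/-- Affine substitutions preserve `P_r`. -/
lemma aeval_mem_polyP {L : Fin 2 → Poly} (hL : ∀ k, (L k).totalDegree ≤ 1) {r : ℕ} {p : Poly}
    (hp : p ∈ polyP r) : MvPolynomial.aeval L p ∈ polyP r := by
  rw [polyP_eq_span] at hp
  have : Submodule.span ℝ {p | ∃ i j, i + j ≤ r ∧ p = mono i j} ≤
      (polyP r).comap (MvPolynomial.aeval (R := ℝ) L).toLinearMap := by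
    rw [Submodule.span_le]
    rintro _ ⟨i, j, hij, rfl⟩
    change MvPolynomial.aeval L (mono i j) ∈ polyP r
    rw [aeval_mono, mem_polyP]
    refine (MvPolynomial.totalDegree_mul _ _).trans ?_
    have h0 := totalDegree_pow_le (hL 0) i
    have h1 := totalDegree_pow_le (hL 1) j
    omega
  exact this hp

/-- An affine substitution under which one of the variables becomes constant maps `Q_r` into
`P_r`: this is the restriction to a line parallel to an axis. -/
lemma aeval_mem_polyP_of_mem_polyQ {L : Fin 2 → Poly} (hL : ∀ k, (L k).totalDegree ≤ 1)
    (hc : ∃ k, (L k).totalDegree = 0) {r : ℕ} {p : Poly} (hp : p ∈ polyQ r) :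
    MvPolynomial.aeval L p ∈ polyP r := by
  have : polyQ r ≤ (polyP r).comap (MvPolynomial.aeval (R := ℝ) L).toLinearMap := by
    rw [polyQ, polyPP, Submodule.span_le]
    rintro _ ⟨i, j, hi, hj, rfl⟩
    change MvPolynomial.aeval L (mono i j) ∈ polyP r
    rw [aeval_mono, mem_polyP]
    refine (MvPolynomial.totalDegree_mul _ _).trans ?_
    have h0 := totalDegree_pow_le (hL 0) i
    have h1 := totalDegree_pow_le (hL 1) j
    obtain ⟨k, hk⟩ := hc
    fin_cases k
    · have := totalDegree_pow_le (le_of_eq hk) i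
      change (L 0 ^ i).totalDegree ≤ _ at this
      omega
    · have := totalDegree_pow_le (le_of_eq hk) j
      change (L 1 ^ j).totalDegree ≤ _ at this
      omega
  exact this hp

/-- The part of the test space on which equilibrium follows from the discrete problem: `P_r` on
triangles and `Q_r` on quadrilaterals. -/
noncomputable def testPoly (s : Shape) (r : ℕ) : Submodule ℝ Poly :=
  match s with
  | .tri => polyP r
  | .quad => polyQ r

lemma testPoly_le_refX (s : Shape) (r : ℕ) : testPoly s r ≤ refX r s := by
  cases s
  · refine le_trans ?_ le_sup_left
    refine (polyP_mono (Nat.le_succ r)).trans ?_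
    unfold polyPPH
    split_ifs
    · exact le_rfl
    · exact le_sup_left
  · exact (polyPP_mono (Nat.le_succ r) (Nat.le_succ r)).trans le_sup_left

lemma C_mem_testPoly (s : Shape) (r : ℕ) (c : ℝ) : MvPolynomial.C c ∈ testPoly s r := by
  cases s
  · exact mem_polyP.2 (by simp)
  · have : (MvPolynomial.C c : Poly) = c • mono 0 0 := by
      simp [mono, MvPolynomial.smul_eq_C_mul]
    rw [this]
    exact Submodule.smul_mem _ _ (Submodule.subset_span ⟨0, 0, by simp, by simp, rfl⟩)

/-- `R_r = Q_r + Φ_r`: the monomials of `R_r` outside `Q_r` are those of the auxiliary space. -/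
lemma polyR_le (r : ℕ) : polyR r ≤ polyQ r ⊔ refPhi r := by
  rw [polyR, Submodule.span_le]
  rintro _ ⟨i, j, hi, hj, hij, rfl⟩
  by_cases h : i ≤ r ∧ j ≤ r
  · exact Submodule.mem_sup_left (Submodule.subset_span ⟨i, j, h.1, h.2, rfl⟩)
  · refine Submodule.mem_sup_right (Submodule.subset_span ?_)
    rcases Nat.lt_or_ge r i with hri | hri
    · obtain rfl : i = r + 1 := by omega
      exact ⟨j, by by_contra hh; exact hij (by simp; omega), Or.inl rfl⟩
    · obtain rfl : j = r + 1 := by omega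
      exact ⟨i, hri, Or.inr rfl⟩

/-! ### Test functions on an element -/

lemma convexPolygon_ne {s : Shape} {V : Fin s.n → Plane} (hV : IsConvexPolygon s V)
    (i : Fin s.n) : V i ≠ V (i + 1) := by
  intro h
  have := hV i
  simp [h, cross] at this

lemma totalDegree_affine_le (α β : ℝ) (k : Fin 2) :
    (MvPolynomial.C α * (MvPolynomial.X k - MvPolynomial.C β) : Poly).totalDegree ≤ 1 := by
  refine (MvPolynomial.totalDegree_mul _ _).trans ?_
  rw [MvPolynomial.totalDegree_C, zero_add]
  refine (MvPolynomial.totalDegree_sub_C_le _ _).trans ?_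
  rw [MvPolynomial.totalDegree_X]

/-- The traces of mapped test functions are polynomials of degree at most `r` on the edges: on
quadrilaterals one reference coordinate is constant along each edge. -/
lemma exists_edge_poly {s : Shape} {V : Fin s.n → Plane} (hV : IsConvexPolygon s V) {r : ℕ}
    {p : Poly} (hp : p ∈ testPoly s r) (i : Fin s.n) :
    ∃ q ∈ polyP r, ∀ t : ℝ,
      pev p (refEdge s i t) = pev q (AffineMap.lineMap (V i) (V (i + 1)) t) := by
  set h := V (i + 1) - V i with hh
  have hne : h 0 * h 0 + h 1 * h 1 ≠ 0 := by
    intro h0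
    have e0 : h 0 = 0 := by nlinarith [sq_nonneg (h 0), sq_nonneg (h 1)]
    have e1 : h 1 = 0 := by nlinarith [sq_nonneg (h 0), sq_nonneg (h 1)]
    refine convexPolygon_ne hV i (sub_eq_zero.1 ?_).symm
    rw [← hh]
    ext k
    fin_cases k
    · simpa using e0
    · simpa using e1
  -- the affine function which is the parameter `t` on the edge
  let T : Poly := ∑ j, MvPolynomial.C (h j / (h 0 * h 0 + h 1 * h 1)) *
    (MvPolynomial.X j - MvPolynomial.C (V i j))
  have hT : ∀ t : ℝ, pev T (AffineMap.lineMap (V i) (V (i + 1)) t) = t := by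
    intro t
    have hl : ∀ j, (AffineMap.lineMap (V i) (V (i + 1)) t : Plane) j - V i j = t * h j := by
      intro j; simp [AffineMap.lineMap_apply_module, hh]; ring
    simp only [T, Fin.sum_univ_two, pev_add, pev_mul, pev_C, pev_sub, pev_X, hl]
    rw [div_mul_eq_mul_div, div_mul_eq_mul_div, ← add_div, div_eq_iff hne]
    ring
  have hTd : T.totalDegree ≤ 1 :=
    MvPolynomial.totalDegree_finsetSum_le fun j _ => totalDegree_affine_le _ _ _
  let L : Fin 2 → Poly := fun k => MvPolynomial.C (refVert s i k) +
    MvPolynomial.C ((refVert s (i + 1) - refVert s i) k) * T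
  have hL : ∀ k, (L k).totalDegree ≤ 1 := by
    intro k
    refine (MvPolynomial.totalDegree_add _ _).trans (max_le (by simp) ?_)
    refine (MvPolynomial.totalDegree_mul _ _).trans ?_
    rw [MvPolynomial.totalDegree_C, zero_add]
    exact hTd
  refine ⟨MvPolynomial.aeval L p, ?_, fun t => ?_⟩
  · cases s
    · exact aeval_mem_polyP hL hp
    · refine aeval_mem_polyP_of_mem_polyQ hL ?_ hp
      have : ∃ k, (refVert .quad (i + 1) - refVert .quad i) k = 0 := by
        change Fin 4 at i
        have h2 := refVert_sub_quad i
        change refVert .quad (i + 1 : Fin 4) - refVert .quad i = _ at h2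
        change ∃ k, (refVert .quad (i + 1 : Fin 4) - refVert .quad i) k = 0
        rw [h2]
        fin_cases i
        exacts [⟨1, by simp⟩, ⟨0, by simp⟩, ⟨1, by simp⟩, ⟨0, by simp⟩]
      obtain ⟨k, hk⟩ := this
      exact ⟨k, by simp only [L, hk]; simp⟩
  · rw [pev_aeval]
    congr 1
    ext k
    simp only [L, pev_add, pev_mul, pev_C, hT, refEdge_apply]
    ring

/-- The gradients of mapped test functions belong to the auxiliary space `Ψ_r(K)`. -/
lemma exists_mem_spacePsi {s : Shape} {V : Fin s.n → Plane} (hV : IsConvexPolygon s V) {r : ℕ}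
    {vh : Fin 2 → Poly} (hvh : ∀ i, vh i ∈ testPoly s r) :
    ∃ τ ∈ spacePsi r s V, ∀ x ∈ closure (refElem s),
      τ (refMap s V x) = polyGrad vh x * (jac (refMap s V) x)⁻¹ := by
  cases s
  · obtain ⟨a, b, c, d, hF, hd⟩ := refMap_eq_bil .tri V
    obtain rfl := hd rfl
    -- the Jacobian is constant, and the inverse of the element map is affine
    let B : Tensor := (bilJac b c 0 0)⁻¹
    have hJc : ∀ x, bilJac b c 0 x = bilJac b c 0 0 := fun x => by simp [bilJac]
    have hJ0 : (bilJac b c 0 0).det ≠ 0 := by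
      have := jac_refMap_det_pos hV (refVert_mem .tri 0)
      rw [hF, jac_bil, hJc] at this
      exact this.ne'
    let L : Fin 2 → Poly := fun k => ∑ j, MvPolynomial.C (B k j) *
      (MvPolynomial.X j - MvPolynomial.C (a j))
    have hL : ∀ k, (L k).totalDegree ≤ 1 := fun k =>
      MvPolynomial.totalDegree_finsetSum_le fun j _ => totalDegree_affine_le _ _ _
    have hLF : ∀ x k, pev (L k) (bil a b c 0 x) = x k := by
      intro x k
      have hB : B * bilJac b c 0 0 = 1 := Matrix.nonsing_inv_mul _ hJ0.isUnit
      have h1 := congrFun (congrArg (fun M => Matrix.mulVec M (fun j => x j)) hB) k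
      rw [Matrix.one_mulVec] at h1
      simp only [Matrix.mulVec, dotProduct, Matrix.mul_apply, Fin.sum_univ_two] at h1
      rw [← h1]
      simp only [L, Fin.sum_univ_two, pev_add, pev_mul, pev_C, pev_sub, pev_X, bil_apply]
      simp [bilJac]
      ring
    let q : Fin 2 → Fin 2 → Poly := fun i j =>
      ∑ k, B k j • MvPolynomial.aeval L (MvPolynomial.pderiv k (vh i))
    refine ⟨fun y => Matrix.of fun i j => pev (q i j) y, ⟨q, fun i j => ?_, fun _ _ _ _ => rfl⟩,
      fun x _ => ?_⟩
    · exact Submodule.sum_mem _ fun k _ => Submodule.smul_mem _ _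
        (aeval_mem_polyP hL (pderiv_mem_polyP (hvh i) k))
    · rw [hF, jac_bil, hJc]
      ext i j
      have : (WithLp.toLp 2 fun k => x k : Plane) = x := rfl
      simp only [Matrix.of_apply, q, pev_sum, Matrix.mul_apply, polyGrad,
        MvPolynomial.smul_eq_C_mul, pev_mul, pev_C, pev_aeval, hLF, this]
      exact Finset.sum_congr rfl fun k _ => mul_comm _ _
  · let G : Plane → Tensor := fun x => polyGrad vh x * (jac (refMap .quad V) x)⁻¹
    have hG : ∀ x ∈ closure (refElem .quad),
        G (Function.invFunOn (refMap .quad V) (closure (refElem .quad)) (refMap .quad V x)) =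
          G x := fun x hx => by
      rw [(refMap_injOn hV).leftInvOn_invFunOn hx]
    exact ⟨fun y => G (Function.invFunOn (refMap .quad V) (closure (refElem .quad)) y),
      ⟨fun i j => MvPolynomial.pderiv j (vh i),
        fun i => ⟨pderiv_zero_mem_polyPP (hvh i), pderiv_one_mem_polyPP (hvh i)⟩, hG⟩, hG⟩

/-! ### Integrals over an element -/

lemma continuous_jac_refMap (s : Shape) (V : Fin s.n → Plane) :
    Continuous (jac (refMap s V)) := by
  obtain ⟨a, b, c, d, h, -⟩ := refMap_eq_bil s V
  have : jac (refMap s V) = bilJac b c d := funext fun x => by rw [h, jac_bil]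
  rw [this]
  refine continuous_matrix fun i j => ?_
  fin_cases i <;> fin_cases j <;> simp [bilJac] <;> fun_prop

lemma continuousOn_jac_inv {s : Shape} {V : Fin s.n → Plane} (hV : IsConvexPolygon s V)
    (i j : Fin 2) :
    ContinuousOn (fun x => (jac (refMap s V) x)⁻¹ i j) (closure (refElem s)) := by
  have hc := continuous_jac_refMap s V
  simp only [Matrix.inv_def, Ring.inverse_eq_inv', Matrix.smul_apply, smul_eq_mul]
  refine ContinuousOn.mul (hc.matrix_det.continuousOn.inv₀ fun x hx =>
    (jac_refMap_det_pos hV hx).ne') ?_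
  exact (hc.matrix_adjugate.matrix_elem i j).continuousOn

lemma hasFDerivWithinAt_refMap (s : Shape) (V : Fin s.n → Plane) :
    ∃ F' : Plane → Plane →L[ℝ] Plane, (∀ x, (F' x).det = (jac (refMap s V) x).det) ∧
      ∀ x ∈ refElem s, HasFDerivWithinAt (refMap s V) (F' x) (refElem s) x := by
  obtain ⟨a, b, c, d, h, -⟩ := refMap_eq_bil s V
  refine ⟨bilDeriv b c d, fun x => ?_, fun x _ => ?_⟩
  · rw [h, jac_bil, bilDeriv_det]
  · rw [h]
    exact (hasStrictFDerivAt_bil a b c d x).hasFDerivAt.hasFDerivWithinAt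

/-- Change of variables; the Jacobian determinant is positive, so no absolute value is needed. -/
lemma integral_elem {s : Shape} {V : Fin s.n → Plane} (hV : IsConvexPolygon s V)
    (g : Plane → ℝ) :
    ∫ x in elem s V, g x = ∫ x in refElem s, (jac (refMap s V) x).det * g (refMap s V x) := by
  obtain ⟨F', hdet, hF'⟩ := hasFDerivWithinAt_refMap s V
  have hm := (isOpen_refElem s).measurableSet
  rw [elem, integral_image_eq_integral_abs_det_fderiv_smul volume hm hF'
    ((refMap_injOn hV).mono subset_closure)]
  refine setIntegral_congr_fun hm fun x hx => ?_
  simp only [hdet, smul_eq_mul]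
  rw [abs_of_pos (jac_refMap_det_pos hV (subset_closure hx))]

lemma integrableOn_elem {s : Shape} {V : Fin s.n → Plane} (hV : IsConvexPolygon s V)
    {g gh : Plane → ℝ} (hg : ∀ x ∈ refElem s, g (refMap s V x) = gh x)
    (hgh : ContinuousOn gh (closure (refElem s))) : IntegrableOn g (elem s V) := by
  obtain ⟨F', hdet, hF'⟩ := hasFDerivWithinAt_refMap s V
  have hm := (isOpen_refElem s).measurableSet
  rw [elem, integrableOn_image_iff_integrableOn_abs_det_fderiv_smul volume hm hF'
    ((refMap_injOn hV).mono subset_closure)]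
  have : IntegrableOn (fun x => |(jac (refMap s V) x).det| * gh x) (refElem s) :=
    integrableOn_refElem ((continuous_jac_refMap s V).matrix_det.abs.continuousOn.mul hgh)
  refine this.congr_fun (fun x hx => ?_) hm
  simp only [hdet, smul_eq_mul, hg x hx]

lemma continuous_refMap (s : Shape) (V : Fin s.n → Plane) : Continuous (refMap s V) := by
  obtain ⟨a, b, c, d, h, -⟩ := refMap_eq_bil s V
  rw [h]
  exact continuous_iff_continuousAt.2 fun x =>
    (hasStrictFDerivAt_bil a b c d x).hasFDerivAt.continuousAt

lemma measurableSet_elem {s : Shape} {V : Fin s.n → Plane} (hV : IsConvexPolygon s V) :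
    MeasurableSet (elem s V) :=
  (isOpen_refElem s).measurableSet.image_of_continuousOn_injOn
    (continuous_refMap s V).continuousOn ((refMap_injOn hV).mono subset_closure)

lemma volume_elem_lt_top (s : Shape) (V : Fin s.n → Plane) : volume (elem s V) < ⊤ :=
  (measure_mono (Set.image_mono subset_closure)).trans_lt
    ((isCompact_closure_refElem s).image (continuous_refMap s V)).measure_lt_top

/-! ### Fields given on the reference element -/

/-- `v` is the vector field `v̂ ∘ F_K⁻¹` on the closed element. -/
def IsMapped (s : Shape) (V : Fin s.n → Plane) (vh : Fin 2 → Poly) (v : Plane → Plane) : Prop :=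
  ∀ x ∈ closure (refElem s), ∀ i, v (refMap s V x) i = pev (vh i) x

lemma exists_isMapped {s : Shape} {V : Fin s.n → Plane} (hV : IsConvexPolygon s V)
    (vh : Fin 2 → Poly) : ∃ v, IsMapped s V vh v :=
  ⟨fun y => WithLp.toLp 2 fun i =>
    pev (vh i) (Function.invFunOn (refMap s V) (closure (refElem s)) y), fun x hx i => by
      change pev (vh i) _ = _
      rw [(refMap_injOn hV).leftInvOn_invFunOn hx]⟩

lemma IsMapped.jac_eq {s : Shape} {V : Fin s.n → Plane} (hV : IsConvexPolygon s V)
    {vh : Fin 2 → Poly} {v : Plane → Plane} (hv : IsMapped s V vh v) {x : Plane}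
    (hx : x ∈ refElem s) :
    jac v (refMap s V x) = polyGrad vh x * (jac (refMap s V) x)⁻¹ := by
  have hJ := (jac_refMap_det_pos hV (subset_closure hx)).ne'
  have hv' : ∀ x ∈ refElem s, ∀ i, v (refMap s V x) i = pev (vh i) x :=
    fun x hx => hv x (subset_closure hx)
  obtain ⟨a, b, c, d, h, -⟩ := refMap_eq_bil s V
  rw [h] at hJ hv' ⊢
  rw [jac_bil] at hJ ⊢
  exact jac_of_pullback (isOpen_refElem s) hv' hx hJ

lemma continuousOn_polyGrad_mul_inv {s : Shape} {V : Fin s.n → Plane} (hV : IsConvexPolygon s V)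
    (vh : Fin 2 → Poly) (i j : Fin 2) :
    ContinuousOn (fun x => (polyGrad vh x * (jac (refMap s V) x)⁻¹) i j)
      (closure (refElem s)) := by
  simp only [Matrix.mul_apply]
  exact continuousOn_finsetSum _ fun k _ =>
    (continuous_pev _).continuousOn.mul (continuousOn_jac_inv hV k j)

/-- `τ` is the Piola image of the tensor field `τ̂` on the closed element. -/
def IsPiola (s : Shape) (V : Fin s.n → Plane) (τh : Fin 2 → Fin 2 → Poly) (τ : Plane → Tensor) :
    Prop :=
  ∀ x ∈ closure (refElem s), τ (refMap s V x) = ((jac (refMap s V) x).det)⁻¹ •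
    ((Matrix.of fun i j => pev (τh i j) x) * (jac (refMap s V) x).transpose)

lemma IsPiola.tdiv_eq {s : Shape} {V : Fin s.n → Plane} (hV : IsConvexPolygon s V)
    {τh : Fin 2 → Fin 2 → Poly} {τ : Plane → Tensor} (hτ : IsPiola s V τh τ) {x : Plane}
    (hx : x ∈ refElem s) (i : Fin 2) :
    tdiv τ (refMap s V x) i = ((jac (refMap s V) x).det)⁻¹ *
      ∑ j, pev (MvPolynomial.pderiv j (τh i j)) x := by
  have hJ := (jac_refMap_det_pos hV (subset_closure hx)).ne'
  have hτ' := fun x (hx : x ∈ refElem s) => hτ x (subset_closure hx)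
  obtain ⟨a, b, c, d, h, -⟩ := refMap_eq_bil s V
  rw [h] at hJ hτ' ⊢
  simp only [jac_bil] at hJ hτ' ⊢
  exact tdiv_of_pullback (isOpen_refElem s) hτ' hx hJ i

lemma inner_plane (x y : Plane) : inner ℝ x y = ∑ i, y i * x i := by
  simp [PiLp.inner_apply]

/-- The factor `det DF` of the change of variables cancels the one in the Piola divergence. -/
lemma integral_tdiv_inner {s : Shape} {V : Fin s.n → Plane} (hV : IsConvexPolygon s V)
    {τh : Fin 2 → Fin 2 → Poly} {τ : Plane → Tensor} (hτ : IsPiola s V τh τ)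
    {vh : Fin 2 → Poly} {v : Plane → Plane} (hv : IsMapped s V vh v) :
    ∫ x in elem s V, inner ℝ (tdiv τ x) (v x) =
      ∫ x in refElem s, pev (∑ i, ∑ j, vh i * MvPolynomial.pderiv j (τh i j)) x := by
  rw [integral_elem hV]
  refine setIntegral_congr_fun (isOpen_refElem s).measurableSet fun x hx => ?_
  have hJ := (jac_refMap_det_pos hV (subset_closure hx)).ne'
  simp only [inner_plane, hv x (subset_closure hx), hτ.tdiv_eq hV hx, pev_sum, pev_mul,
    Finset.mul_sum]
  refine Finset.sum_congr rfl fun i _ => Finset.sum_congr rfl fun j _ => ?_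
  field_simp

/-- The Piola factor `DFᵗ / det DF` cancels the `DF⁻¹` of the gradient and the Jacobian of the
change of variables. -/
lemma integral_frob_piola {s : Shape} {V : Fin s.n → Plane} (hV : IsConvexPolygon s V)
    {τh : Fin 2 → Fin 2 → Poly} {τ : Plane → Tensor} (hτ : IsPiola s V τh τ)
    {vh : Fin 2 → Poly} {η : Plane → Tensor} (hη : ∀ x ∈ closure (refElem s),
      η (refMap s V x) = polyGrad vh x * (jac (refMap s V) x)⁻¹) :
    ∫ x in elem s V, frob (τ x) (η x) =
      ∫ x in refElem s, pev (∑ i, ∑ j, τh i j * MvPolynomial.pderiv j (vh i)) x := by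
  rw [integral_elem hV]
  refine setIntegral_congr_fun (isOpen_refElem s).measurableSet fun x hx => ?_
  have hJ := (jac_refMap_det_pos hV (subset_closure hx)).ne'
  simp only [hτ x (subset_closure hx), hη x (subset_closure hx), pev_sum, pev_mul]
  generalize jac (refMap s V) x = J at hJ ⊢
  have hd := Matrix.det_fin_two J
  simp only [frob, Matrix.inv_def, Ring.inverse_eq_inv', Matrix.adjugate_fin_two,
    Matrix.smul_apply, Matrix.mul_apply, Matrix.transpose_apply, Fin.sum_univ_two, Matrix.of_apply,
    polyGrad, smul_eq_mul, Matrix.cons_val_zero, Matrix.cons_val_one, Matrix.cons_val',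
    Matrix.cons_val_fin_one]
  generalize J.det = D at hJ hd ⊢
  field_simp
  rw [hd]
  ring

/-! ### Arc-length measure -/

lemma measurableEmbedding_lineMap {a b : Plane} (hab : a ≠ b) :
    MeasurableEmbedding fun t : ℝ => (AffineMap.lineMap a b t : Plane) :=
  (AffineMap.lineMap_continuous (R := ℝ)).measurableEmbedding
    (AffineMap.lineMap_injective ℝ hab)

lemma ae_segMeasure {a b : Plane} (hab : a ≠ b) {P : Plane → Prop} :
    (∀ᵐ x ∂segMeasure a b, P x) ↔
      ∀ᵐ t ∂volume.restrict (Set.Icc (0 : ℝ) 1), P (AffineMap.lineMap a b t) := by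
  rw [segMeasure, Measure.ae_ennreal_smul_measure_iff (by simpa using hab),
    (measurableEmbedding_lineMap hab).ae_map_iff]

lemma integrable_segMeasure {a b : Plane} (hab : a ≠ b) {g : Plane → ℝ} :
    Integrable g (segMeasure a b) ↔
      IntegrableOn (fun t : ℝ => g (AffineMap.lineMap a b t)) (Set.Icc 0 1) := by
  rw [segMeasure, integrable_smul_measure (by simpa using hab) ENNReal.ofReal_ne_top,
    (measurableEmbedding_lineMap hab).integrable_map_iff]
  rfl

lemma integral_segMeasure {a b : Plane} (hab : a ≠ b) (g : Plane → ℝ) :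
    ∫ x, g x ∂segMeasure a b =
      ∫ t in (0 : ℝ)..1, dist a b * g (AffineMap.lineMap a b t) := by
  rw [segMeasure, integral_smul_measure, (measurableEmbedding_lineMap hab).integral_map,
    intervalIntegral.integral_of_le zero_le_one, integral_Icc_eq_integral_Ioc,
    integral_const_mul, ENNReal.toReal_ofReal dist_nonneg, smul_eq_mul]

lemma ae_bdryMeasure {s : Shape} {V : Fin s.n → Plane} {P : Plane → Prop} :
    (∀ᵐ x ∂bdryMeasure s V, P x) ↔ ∀ i, ∀ᵐ x ∂edgeMeasure s V i, P x := by
  simp [bdryMeasure, ae_finsetSum_measure_iff]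

lemma integrable_bdryMeasure {s : Shape} {V : Fin s.n → Plane} {g : Plane → ℝ} :
    Integrable g (bdryMeasure s V) ↔ ∀ i, Integrable g (edgeMeasure s V i) := by
  simp [bdryMeasure, integrable_finsetSum_measure]

lemma ae_bdryMeasure_of_forall {s : Shape} {V : Fin s.n → Plane} (hV : IsConvexPolygon s V)
    {P : Plane → Prop} (h : ∀ x ∈ closure (refElem s), P (refMap s V x)) :
    ∀ᵐ x ∂bdryMeasure s V, P x := by
  refine ae_bdryMeasure.2 fun i => (ae_segMeasure (convexPolygon_ne hV i)).2 ?_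
  filter_upwards [ae_restrict_mem measurableSet_Icc] with t ht
  rw [← refMap_refEdge]
  exact h _ (refEdge_mem s i ht)

lemma IsMapped.mem_spaceE {s : Shape} {V : Fin s.n → Plane} (hV : IsConvexPolygon s V) {r : ℕ}
    {vh : Fin 2 → Poly} (hvh : ∀ i, vh i ∈ testPoly s r) {v : Plane → Plane}
    (hv : IsMapped s V vh v) : v ∈ spaceE s V r := by
  intro i
  choose q hq hqe using fun k => exists_edge_poly hV (hvh k) i
  refine ⟨q, hq, (ae_segMeasure (convexPolygon_ne hV i)).2 ?_⟩
  filter_upwards [ae_restrict_mem measurableSet_Icc] with t ht k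
  rw [← hqe, ← refMap_refEdge, hv _ (refEdge_mem s i ht)]

lemma IsMapped.integrable_bdry {s : Shape} {V : Fin s.n → Plane} (hV : IsConvexPolygon s V)
    {vh : Fin 2 → Poly} {v : Plane → Plane} (hv : IsMapped s V vh v) (k : Fin 2) :
    Integrable (fun x => v x k) (bdryMeasure s V) := by
  refine integrable_bdryMeasure.2 fun i => (integrable_segMeasure (convexPolygon_ne hV i)).2 ?_
  have : IntegrableOn (fun t => pev (vh k) (refEdge s i t)) (Set.Icc 0 1) :=
    ((continuous_pev _).comp (continuous_refEdge s i)).continuousOn.integrableOn_compact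
      isCompact_Icc
  refine this.congr_fun (fun t ht => ?_) measurableSet_Icc
  change _ = v _ k
  rw [← refMap_refEdge, hv _ (refEdge_mem s i ht)]

lemma exists_pev_bound (s : Shape) (p : Poly) : ∃ M, ∀ x ∈ closure (refElem s), ‖pev p x‖ ≤ M :=
  (isCompact_closure_refElem s).exists_bound_of_continuousOn (continuous_pev p).continuousOn

lemma IsMapped.integrable_inner_bdry {s : Shape} {V : Fin s.n → Plane} (hV : IsConvexPolygon s V)
    {vh : Fin 2 → Poly} {v : Plane → Plane} (hv : IsMapped s V vh v) {g : Plane → Plane}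
    {Γ : Set Plane} (hg : Integrable g ((bdryMeasure s V).restrict Γ)) :
    Integrable (fun x => inner ℝ (g x) (v x)) ((bdryMeasure s V).restrict Γ) := by
  simp only [inner_plane]
  refine integrable_finsetSum _ fun k _ => ?_
  obtain ⟨M, hM⟩ := exists_pev_bound s (vh k)
  refine Integrable.bdd_mul (c := M) ((EuclideanSpace.proj (𝕜 := ℝ) k).integrable_comp hg)
    (hv.integrable_bdry hV k).restrict.aestronglyMeasurable (ae_restrict_of_ae ?_)
  refine ae_bdryMeasure_of_forall hV fun x hx => ?_
  rw [hv x hx]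
  exact hM x hx

lemma isConvexPolygon_refVert (s : Shape) : IsConvexPolygon s (refVert s) := by
  intro i
  cases s
  · change Fin 3 at i
    change 0 < cross (refVert .tri (i + 1 : Fin 3) - refVert .tri i)
      (refVert .tri (i + 1 + 1 : Fin 3) - refVert .tri (i + 1 : Fin 3))
    rw [refVert_sub_tri, refVert_sub_tri]
    fin_cases i <;> simp [cross]
  · change Fin 4 at i
    change 0 < cross (refVert .quad (i + 1 : Fin 4) - refVert .quad i)
      (refVert .quad (i + 1 + 1 : Fin 4) - refVert .quad (i + 1 : Fin 4))
    rw [refVert_sub_quad, refVert_sub_quad]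
    fin_cases i <;> simp [cross]

/-- Multipliers are integrable on the boundary of the element. -/
lemma integrable_of_mem_spaceM {s : Shape} {V : Fin s.n → Plane} (hV : IsConvexPolygon s V)
    {r : ℕ} {m : Plane → Plane} (hm : m ∈ spaceM s V r) : Integrable m (bdryMeasure s V) := by
  have hV' := isConvexPolygon_refVert s
  obtain ⟨lh, hlh, hml⟩ := hm
  refine Integrable.of_eval_piLp fun k => ?_
  refine integrable_bdryMeasure.2 fun i => (integrable_segMeasure (convexPolygon_ne hV i)).2 ?_
  obtain ⟨q, -, hq⟩ := hlh i
  have h1 := (ae_segMeasure (convexPolygon_ne hV' i)).1 hq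
  have h2 := (ae_segMeasure (convexPolygon_ne hV' i)).1 (ae_bdryMeasure.1 hml i)
  have : IntegrableOn (fun t => pev (q k) (refEdge s i t)) (Set.Icc 0 1) :=
    ((continuous_pev _).comp (continuous_refEdge s i)).continuousOn.integrableOn_compact
      isCompact_Icc
  refine this.congr ?_
  filter_upwards [h1, h2] with t ht1 ht2
  have e1 := refMap_refEdge s V i t
  rw [refEdge] at e1
  rw [← e1, ht2, ht1 k, refEdge]

/-- The Piola transformation preserves normal fluxes. -/
lemma bdryTraction_piola {s : Shape} {V : Fin s.n → Plane} (hV : IsConvexPolygon s V)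
    {τh : Fin 2 → Fin 2 → Poly} {τ : Plane → Tensor} (hτ : IsPiola s V τh τ)
    {vh : Fin 2 → Poly} {v : Plane → Plane} (hv : IsMapped s V vh v) :
    bdryTraction s V τ v = ∑ i, ∫ t in (0 : ℝ)..1,
      (pev (∑ c, τh c 0 * vh c) (refEdge s i t) * (refVert s (i + 1) - refVert s i) 1 -
        pev (∑ c, τh c 1 * vh c) (refEdge s i t) * (refVert s (i + 1) - refVert s i) 0) := by
  refine Finset.sum_congr rfl fun i _ => ?_
  rw [edgeMeasure, integral_segMeasure (convexPolygon_ne hV i)]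
  refine intervalIntegral.integral_congr fun t ht => ?_
  rw [Set.uIcc_of_le zero_le_one] at ht
  have hx := refEdge_mem s i ht
  have hJ := (jac_refMap_det_pos hV hx).ne'
  have hdist : dist (V i) (V (i + 1)) ≠ 0 := dist_ne_zero.2 (convexPolygon_ne hV i)
  have k0 := jac_refMap_edge s V i t 0
  have k1 := jac_refMap_edge s V i t 1
  have hn0 : outNormal s V i 0 = (dist (V i) (V (i + 1)))⁻¹ * (V (i + 1) - V i) 1 := by
    simp [outNormal]
  have hn1 : outNormal s V i 1 = -((dist (V i) (V (i + 1)))⁻¹ * (V (i + 1) - V i) 0) := by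
    simp [outNormal]
    ring
  simp only [← refMap_refEdge, inner_plane, hv _ hx, applyT, hτ _ hx, Fin.sum_univ_two, hn0, hn1,
    ← k0, ← k1, pev_add, pev_mul]
  generalize jac (refMap s V) (refEdge s i t) = J at hJ ⊢
  generalize dist (V i) (V (i + 1)) = δ at hdist ⊢
  have hd := Matrix.det_fin_two J
  simp only [Matrix.smul_apply, Matrix.mul_apply, Matrix.transpose_apply, Fin.sum_univ_two,
    Matrix.of_apply, smul_eq_mul]
  generalize J.det = D at hJ hd ⊢
  field_simp
  rw [hd]
  ring

/-- Green's formula on an element, for a Piola-mapped stress and a mapped displacement. -/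
lemma green_elem {s : Shape} {V : Fin s.n → Plane} (hV : IsConvexPolygon s V)
    {τh : Fin 2 → Fin 2 → Poly} {τ : Plane → Tensor} (hτ : IsPiola s V τh τ)
    {vh : Fin 2 → Poly} {v : Plane → Plane} (hv : IsMapped s V vh v) {η : Plane → Tensor}
    (hη : ∀ x ∈ closure (refElem s),
      η (refMap s V x) = polyGrad vh x * (jac (refMap s V) x)⁻¹) :
    ∫ x in elem s V, inner ℝ (tdiv τ x) (v x) =
      bdryTraction s V τ v - ∫ x in elem s V, frob (τ x) (η x) := by
  have hint : ∀ q : Poly, IntegrableOn (pev q) (refElem s) := fun q =>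
    integrableOn_refElem (continuous_pev q).continuousOn
  rw [integral_tdiv_inner hV hτ hv, integral_frob_piola hV hτ hη, bdryTraction_piola hV hτ hv,
    ← divergence_refElem s fun j => ∑ c, τh c j * vh c, eq_sub_iff_add_eq,
    ← integral_add (hint _) (hint _)]
  refine setIntegral_congr_fun (isOpen_refElem s).measurableSet fun x _ => ?_
  simp only [map_add, Derivation.leibniz, smul_eq_mul, pev_add, pev_mul, Fin.sum_univ_two]
  ring

/-! ### Equilibrium on one element -/

/-- The recovered traction `t_h` pairs with a mapped field as the sum of the multiplier, which
vanishes on `Γ_N`, and of the load `t_N` on `Γ_N`. -/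
lemma integral_traction {s : Shape} {V : Fin s.n → Plane} (hV : IsConvexPolygon s V) {r : ℕ}
    {ΓN : Set Plane} (hΓN : MeasurableSet ΓN) {tN mK : Plane → Plane}
    (htN : Integrable tN ((bdryMeasure s V).restrict ΓN)) (hm : mK ∈ spaceM s V r)
    (hm0 : ∀ᵐ x ∂bdryMeasure s V, x ∈ ΓN → mK x = 0)
    {vh : Fin 2 → Poly} {v : Plane → Plane} (hv : IsMapped s V vh v) :
    ∫ x, inner ℝ (traction ΓN tN mK x) (v x) ∂bdryMeasure s V =
      (∫ x, inner ℝ (mK x) (v x) ∂bdryMeasure s V) +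
        ∫ x in ΓN, inner ℝ (tN x) (v x) ∂bdryMeasure s V := by
  have h1 : Integrable (fun x => inner ℝ (mK x) (v x)) (bdryMeasure s V) := by
    have := hv.integrable_inner_bdry hV (Γ := Set.univ)
      (g := mK) (by rw [Measure.restrict_univ]; exact integrable_of_mem_spaceM hV hm)
    rwa [Measure.restrict_univ] at this
  have h2 : Integrable (ΓN.indicator fun x => inner ℝ (tN x) (v x)) (bdryMeasure s V) :=
    (integrable_indicator_iff hΓN).2 (hv.integrable_inner_bdry hV htN)
  rw [← integral_indicator hΓN, ← integral_add h1 h2]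
  refine integral_congr_ae ?_
  filter_upwards [hm0] with x hx
  by_cases hxN : x ∈ ΓN
  · simp [traction, hxN, hx hxN]
  · simp [traction, hxN]

lemma jac_zero (x : Plane) : jac (0 : Plane → Plane) x = 0 := by
  ext i j
  simp [jac]

/-- Testing the discrete equilibrium equation with a field supported on one element. -/
lemma discrete_equilibrium_elem {s : Shape} {ι : Type*} [Fintype ι] {Ω : Set Plane}
    {T : Mesh s ι Ω} {r : ℕ} {ΓD ΓN : Set Plane} {μ lam : ℝ} {f uD tN : Plane → Plane}
    {u m : ι → Plane → Plane} {p : ι → Plane → ℝ}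
    (hsol : IsHDPSolution T r ΓD ΓN μ lam f uD tN u m p) (K : ι) {v : Plane → Plane}
    (hv : v ∈ spaceX s (T.vert K) r) :
    (∫ x in elem s (T.vert K), frob ((2 * μ) • strain (u K) x) (strain v x)) +
      ∫ x in elem s (T.vert K), vdiv v x * p K x =
      (∫ x, inner ℝ (m K x) (v x) ∂bdryMeasure s (T.vert K)) +
      (∫ x in ΓN, inner ℝ (tN x) (v x) ∂bdryMeasure s (T.vert K)) -
      ∫ x in elem s (T.vert K), inner ℝ (f x) (v x) := by
  classical
  have hw : Pi.single K v ∈ globX T r := by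
    intro L
    by_cases h : L = K
    · subst h
      rwa [Pi.single_eq_same]
    · rw [Pi.single_eq_of_ne h]
      exact ⟨0, fun i => Submodule.zero_mem _, fun x _ i => by simp [pev]⟩
  have h := hsol.equilibrium _ hw
  rw [formA, formB, formC, loadForm, bdryForm,
    Finset.sum_eq_single K _ (by simp), Finset.sum_eq_single K _ (by simp),
    Finset.sum_eq_single K _ (by simp), Finset.sum_eq_single K _ (by simp),
    Finset.sum_eq_single K _ (by simp)] at h
  · simp only [Pi.single_eq_same] at h
    linarith
  all_goals
    intro L _ hL
    rw [Pi.single_eq_of_ne hL]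
    simp [strain, vdiv, jac_zero, frob]

/-- The discrete stress tested against a gradient: since the stress is symmetric, the gradient may
be replaced by the strain. -/
lemma integral_frob_discrete_stress {s : Shape} {V : Fin s.n → Plane} (hV : IsConvexPolygon s V)
    {r : ℕ} (μ : ℝ) {uh vh : Fin 2 → Poly} {u v : Plane → Plane} (hu : IsMapped s V uh u)
    (hv : IsMapped s V vh v) {p : Plane → ℝ} (hp : p ∈ spaceP s V r) {η : Plane → Tensor}
    (hη : ∀ x ∈ closure (refElem s),
      η (refMap s V x) = polyGrad vh x * (jac (refMap s V) x)⁻¹) :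
    ∫ x in elem s V, frob ((2 * μ) • strain u x + p x • (1 : Tensor)) (η x) =
      (∫ x in elem s V, frob ((2 * μ) • strain u x) (strain v x)) +
        ∫ x in elem s V, vdiv v x * p x := by
  obtain ⟨q, -, hq⟩ := hp
  have cu := continuousOn_polyGrad_mul_inv hV uh
  have cv := continuousOn_polyGrad_mul_inv hV vh
  have cq : Continuous fun x => pev q (refMap s V x) :=
    (continuous_pev q).comp (continuous_refMap s V)
  have hp' : ∀ x ∈ refElem s, p (refMap s V x) = pev q (refMap s V x) := fun x hx =>
    hq _ (subset_closure ⟨x, hx, rfl⟩)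
  rw [← integral_add]
  · refine setIntegral_congr_fun (measurableSet_elem hV) ?_
    rintro _ ⟨x, hx, rfl⟩
    have : η (refMap s V x) = jac v (refMap s V x) := by
      rw [hη x (subset_closure hx), hv.jac_eq hV hx]
    simp only [this, frob, strain, vdiv, Matrix.trace, Fin.sum_univ_two, Matrix.add_apply,
      Matrix.smul_apply, Matrix.transpose_apply, Matrix.diag_apply, smul_eq_mul, Matrix.one_apply]
    simp
    ring
  · refine integrableOn_elem hV (gh := fun x => ∑ i, ∑ j,
      (2 * μ) * (1 / 2 * ((polyGrad uh x * (jac (refMap s V) x)⁻¹) i j +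
        (polyGrad uh x * (jac (refMap s V) x)⁻¹) j i)) *
      (1 / 2 * ((polyGrad vh x * (jac (refMap s V) x)⁻¹) i j +
        (polyGrad vh x * (jac (refMap s V) x)⁻¹) j i))) (fun x hx => ?_) ?_
    · simp only [frob, strain, hu.jac_eq hV hx, hv.jac_eq hV hx, Matrix.add_apply,
        Matrix.smul_apply, Matrix.transpose_apply, smul_eq_mul]
    · refine continuousOn_finsetSum _ fun i _ => continuousOn_finsetSum _ fun j _ => ?_
      exact (continuousOn_const.mul (continuousOn_const.mul ((cu i j).add (cu j i)))).mul
        (continuousOn_const.mul ((cv i j).add (cv j i)))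
  · refine integrableOn_elem hV (gh := fun x =>
      (∑ i, (polyGrad vh x * (jac (refMap s V) x)⁻¹) i i) * pev q (refMap s V x))
      (fun x hx => ?_) ?_
    · rw [hp' x hx, vdiv, hv.jac_eq hV hx]
      rfl
    · exact (continuousOn_finsetSum _ fun i _ => cv i i).mul cq.continuousOn

/-- Equilibrium against the test functions whose gradients lie in `Ψ_r(K)`. -/
lemma local_equilibrium_testPoly {s : Shape} {ι : Type*} [Fintype ι] {Ω : Set Plane}
    {T : Mesh s ι Ω} {r : ℕ} {ΓD ΓN : Set Plane} (hΓN : MeasurableSet ΓN) {μ lam : ℝ}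
    {f uD tN : Plane → Plane} {u m : ι → Plane → Plane} {p : ι → Plane → ℝ}
    (hsol : IsHDPSolution T r ΓD ΓN μ lam f uD tN u m p) {K : ι}
    (htN : Integrable tN ((bdryMeasure s (T.vert K)).restrict ΓN)) {σK : Plane → Tensor}
    (hσ : IsRecoveredStress s (T.vert K) r ΓN μ f tN (u K) (m K) (p K) σK)
    {vh : Fin 2 → Poly} (hvh : ∀ i, vh i ∈ testPoly s r) {v : Plane → Plane}
    (hv : IsMapped s (T.vert K) vh v) :
    ∫ x in elem s (T.vert K), inner ℝ (tdiv σK x) (v x) =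
      ∫ x in elem s (T.vert K), inner ℝ (f x) (v x) := by
  have hV := T.convex K
  obtain ⟨τh, -, hτ⟩ := hσ.mem_S
  obtain ⟨uh, -, hu⟩ := hsol.mem_X K
  obtain ⟨η, hηΨ, hη⟩ := exists_mem_spacePsi hV hvh
  rw [green_elem hV hτ hv hη, hσ.normal v (hv.mem_spaceE hV hvh), hσ.inside η hηΨ,
    integral_frob_discrete_stress hV μ hu hv (hsol.mem_P.1 K) hη,
    integral_traction hV hΓN htN (hsol.mem_M.1 K) (hsol.mem_M.2.1 K) hv,
    discrete_equilibrium_elem hsol K ⟨vh, fun i => testPoly_le_refX s r (hvh i), hv⟩]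
  ring

lemma IsMapped.integrable_inner_elem {s : Shape} {V : Fin s.n → Plane}
    (hV : IsConvexPolygon s V) {vh : Fin 2 → Poly} {v : Plane → Plane} (hv : IsMapped s V vh v)
    {g : Plane → Plane} (hg : IntegrableOn g (elem s V)) :
    IntegrableOn (fun x => inner ℝ (g x) (v x)) (elem s V) := by
  simp only [inner_plane]
  refine integrable_finsetSum _ fun k _ => ?_
  obtain ⟨M, hM⟩ := exists_pev_bound s (vh k)
  refine Integrable.bdd_mul (c := M) ((EuclideanSpace.proj (𝕜 := ℝ) k).integrable_comp hg)
    (integrableOn_elem hV (fun x hx => hv x (subset_closure hx) k)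
      (continuous_pev _).continuousOn).aestronglyMeasurable ?_
  filter_upwards [ae_restrict_mem (measurableSet_elem hV)]
  rintro _ ⟨x, hx, rfl⟩
  rw [hv x (subset_closure hx)]
  exact hM x (subset_closure hx)

lemma IsPiola.integrable_inner_tdiv {s : Shape} {V : Fin s.n → Plane}
    (hV : IsConvexPolygon s V) {τh : Fin 2 → Fin 2 → Poly} {τ : Plane → Tensor}
    (hτ : IsPiola s V τh τ) {vh : Fin 2 → Poly} {v : Plane → Plane} (hv : IsMapped s V vh v) :
    IntegrableOn (fun x => inner ℝ (tdiv τ x) (v x)) (elem s V) := by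
  refine integrableOn_elem hV (gh := fun x => ∑ i, pev (vh i) x *
    (((jac (refMap s V) x).det)⁻¹ * ∑ j, pev (MvPolynomial.pderiv j (τh i j)) x))
    (fun x hx => ?_) ?_
  · simp only [inner_plane, hv x (subset_closure hx), hτ.tdiv_eq hV hx]
  · refine continuousOn_finsetSum _ fun i _ => (continuous_pev _).continuousOn.mul ?_
    refine ((continuous_jac_refMap s V).matrix_det.continuousOn.inv₀ fun x hx =>
      (jac_refMap_det_pos hV hx).ne').mul ?_
    exact continuousOn_finsetSum _ fun j _ => (continuous_pev _).continuousOn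


theorem mainTheorem5 {ι : Type*} [Fintype ι] (s : Shape) (r : ℕ) (hr : 1 ≤ r)
    (Ω : Set Plane) (hΩ_open : IsOpen Ω) (hΩ_sc : SimplyConnectedSpace Ω)
    (hΩ_reg : interior (closure Ω) = Ω)
    (ΓD ΓN : Set Plane) (hΓD_meas : MeasurableSet ΓD) (hΓN_meas : MeasurableSet ΓN)
    (hΓ_union : frontier Ω = closure (ΓD ∪ ΓN)) (hΓ_disj : Disjoint ΓD ΓN)
    (hΓD_pos : 0 < μH[1] ΓD)
    (T : Mesh s ι Ω)
    (μ lam : ℝ) (hμ : 0 < μ) (hlam : 0 < lam)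
    (f uD tN : Plane → Plane)
    (hf : MemLp f 2 (volume.restrict Ω))
    (huD : ∀ K, Integrable uD ((bdryMeasure s (T.vert K)).restrict ΓD))
    (htN : ∀ K, Integrable tN ((bdryMeasure s (T.vert K)).restrict ΓN))
    (u m : ι → Plane → Plane) (p : ι → Plane → ℝ)
    (hsol : IsHDPSolution T r ΓD ΓN μ lam f uD tN u m p)
    (σ : ι → Plane → Tensor)
    (hσ : ∀ K, IsRecoveredStress s (T.vert K) r ΓN μ f tN (u K) (m K) (p K) (σ K)) :
    (∀ K, ∀ v ∈ spaceR s (T.vert K) r,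
      ∫ x in elem s (T.vert K), inner ℝ (tdiv (σ K) x) (v x) =
        ∫ x in elem s (T.vert K), inner ℝ (f x) (v x)) ∧
    (∀ K, ∀ i : Fin 2,
      ∑ j, ∫ x, ∑ k, σ K x i k * outNormal s (T.vert K) j k ∂(edgeMeasure s (T.vert K) j) =
        ∫ x in elem s (T.vert K), f x i) := by

  have hfK : ∀ K, IntegrableOn f (elem s (T.vert K)) := by
    intro K
    have : IsFiniteMeasure (volume.restrict (elem s (T.vert K))) :=
      ⟨by rw [Measure.restrict_apply_univ]; exact volume_elem_lt_top _ _⟩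
    exact (hf.mono_measure (Measure.restrict_mono (T.subset K) le_rfl)).integrable one_le_two
  refine ⟨fun K v hv => ?_, fun K i => ?_⟩
  · obtain ⟨vh, hvh, hv⟩ := hv
    replace hv : IsMapped s (T.vert K) vh v := hv
    cases s
    · exact local_equilibrium_testPoly hΓN_meas hsol (htN K) (hσ K) hvh hv
    · have hV := T.convex K
      obtain ⟨τh, -, hτ⟩ := (hσ K).mem_S
      replace hτ : IsPiola _ _ τh (σ K) := hτ
      -- split the test function along `R_r = Q_r + Φ_r`
      choose v₁ h₁ v₂ h₂ h₁₂ using fun i => Submodule.mem_sup.1 (polyR_le r (hvh i))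
      obtain ⟨w₁, hw₁⟩ := exists_isMapped hV v₁
      obtain ⟨w₂, hw₂⟩ := exists_isMapped hV v₂
      have hsplit : ∀ x ∈ elem .quad (T.vert K), v x = w₁ x + w₂ x := by
        rintro _ ⟨x, hx, rfl⟩
        ext i
        have hx' := subset_closure hx
        rw [PiLp.add_apply, hv x hx', hw₁ x hx', hw₂ x hx', ← h₁₂ i, pev_add]
      have hm := measurableSet_elem hV
      have hsum : ∀ g : Plane → Plane, ∫ x in elem .quad (T.vert K), inner ℝ (g x) (v x) =
          ∫ x in elem .quad (T.vert K), (inner ℝ (g x) (w₁ x) + inner ℝ (g x) (w₂ x)) :=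
        fun g => setIntegral_congr_fun hm fun x hx => by
          simp only [hsplit x hx, inner_add_right]
      rw [hsum, hsum, integral_add (hτ.integrable_inner_tdiv hV hw₁)
          (hτ.integrable_inner_tdiv hV hw₂),
        integral_add (hw₁.integrable_inner_elem hV (hfK K))
          (hw₂.integrable_inner_elem hV (hfK K)),
        local_equilibrium_testPoly hΓN_meas hsol (htN K) (hσ K) h₁ hw₁,
        (hσ K).extra rfl w₂ ⟨v₂, h₂, hw₂⟩]
  · -- the constant field `e i` has zero gradient, so only the boundary term of Green's formula
    -- survives
    have hV := T.convex K
    obtain ⟨τh, -, hτ⟩ := (hσ K).mem_S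
    have hc : IsMapped s (T.vert K) (fun j => MvPolynomial.C (e i j)) fun _ => e i :=
      fun x _ j => (pev_C _ x).symm
    have h := local_equilibrium_testPoly hΓN_meas hsol (htN K) (hσ K)
      (fun j => C_mem_testPoly s r _) hc
    rw [green_elem hV hτ hc (η := 0) fun x _ => by
      have : polyGrad (fun j => MvPolynomial.C (e i j)) x = 0 := by
        ext j k
        simp [polyGrad, pev]
      rw [this, Matrix.zero_mul]; rfl] at h
    have hi : ∀ w : Plane, inner ℝ w (e i) = w i := by
      intro w
      fin_cases i <;> simp [inner_plane, e]
    have hz : ∀ A : Tensor, frob A 0 = 0 := fun A => by simp [frob]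
    simp only [bdryTraction, hi, Pi.zero_apply, hz, integral_zero, sub_zero] at h
    exact h
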